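/- **Theorem (gradients of restricted quantum–classical Boltzmann machines).** Let the visible and hidden systems $v,h$ be finite-dimensional nonzero complex Hilbert spaces, let $V_1,\dots,V_m$ be Hermitian operators on $v$, and let $H_1,\dots,H_n$ be pairwise commuting Hermitian operators on $h$. For $\theta=(a,b,w)$ with $a\in\mathbb{R}^m$, $b\in\mathbb{R}^n$, $w\in\mathbb{R}^{m\times n}$ put $$G(\theta)=\sum_i a_iV_i\otimes I+I\otimes\sum_j b_jH_j+\sum_{i,j}w_{i,j}V_i\otimes H_j,\qquad \sigma_v(\theta)=\operatorname{Tr}_h\!\left[\frac{e^{-G(\theta)}}{\operatorname{Tr}[e^{-G(\theta)}]}\right].$$ Let $\rho$ be a state on $v$ (positive semidefinite, unit trace), and let $D(\rho\|\sigma)=\operatorname{Tr}[\rho\ln\rho]-\operatorname{Tr}[\rho\ln\sigma]$ and $\langle A\rangle_X=\operatorname{Tr}[AX]$. There are an orthonormal basis $\{|x\rangle\}_x$ of $h$ and reals $h_{j,x}$ with $H_j=\sum_x h_{j,x}|x\rangle\!\langle x|$ for all $j$. For every such choice, define $$\tilde G_v^x(\theta)=\sum_i\Big(a_i+\sum_j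 w_{i,j}h_{j,x}\Big)V_i,\qquad G_v^x(\theta)=\sum_j b_jh_{j,x}I+\tilde G_v^x(\theta),$$ $$\sigma_v^x(\theta)=\frac{e^{-G_v^x(\theta)}}{\operatorname{Tr}[e^{-G_v^x(\theta)}]},\qquad p_x(\theta)=\frac{\operatorname{Tr}[e^{-G_v^x(\theta)}]}{\operatorname{Tr}[e^{-G(\theta)}]},$$ $$\Upsilon_v^\theta(X)=\int_{-\infty}^{\infty}\beta(t)\,\sigma_v(\theta)^{-it/2}X\sigma_v(\theta)^{it/2}\,dt,\qquad \beta(t)=\frac{\pi}{2(\cosh(\pi t)+1)},$$ $$\Phi_v^{\theta,x}(Y)=\int_{-\infty}^{\infty}\gamma(t)\,e^{-iG_v^x(\theta)t}Ye^{iG_v^x(\theta)t}\,dt,\qquad \gamma(t)=\frac{2}{\pi}\ln\left|\coth\frac{\pi t}{2}\right|,$$ $$\Xi_v^{\theta,x}(R)=\tfrac12\left\{\sigma_v^x(\theta),\,\sigma_v(\theta)^{-1/2}R\,\sigma_v(\theta)^{-1/2}\right\},\qquad \Sigma_v^{\theta,x}=\Phi_v^{\theta,x}\circ\Xi_v^{\theta,x}\circ\Upsilon_v^\theta,$$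 where $\{A,B\}=AB+BA$, and $$\Lambda_x(\theta)=\Upsilon_v^\theta\!\left(\sigma_v(\theta)^{-1/2}\,p_x(\theta)\sigma_v^x(\theta)\,\sigma_v(\theta)^{-1/2}\right),\qquad q_x(\theta)=\operatorname{Tr}[\Lambda_x(\theta)\rho].$$ Then $(\Lambda_x(\theta))_x$ is a POVM, $(q_x(\theta))_x$ is a probability distribution, and the partial derivatives of $D(\rho\|\sigma_v(\theta))$ exist and are $$\frac{\partial}{\partial a_i}D(\rho\|\sigma_v(\theta))=\sum_x p_x(\theta)\langle V_i\rangle_{\Sigma_v^{\theta,x}(\rho)}-\sum_x p_x(\theta)\langle V_i\rangle_{\sigma_v^x(\theta)},$$ $$\frac{\partial}{\partial b_j}D(\rho\|\sigma_v(\theta))=\sum_x q_x(\theta)h_{j,x}-\sum_x p_x(\theta)h_{j,x},$$ $$\frac{\partial}{\partial w_{i,j}}D(\rho\|\sigma_v(\theta))=\sum_x p_x(\theta)h_{j,x}\langle V_i\rangle_{\Sigma_v^{\theta,x}(\rho)}-\sum_x p_x(\theta)h_{j,x}\langle V_i\rangle_{\sigma_v^x(\theta)}.$$ Moreover, $\sigma_v^x(\theta)=e^{-\tilde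 G_v^x(\theta)}/\operatorname{Tr}[e^{-\tilde G_v^x(\theta)}]$, and $\Phi_v^{\theta,x}$ is a quantum channel (linear, completely positive, trace preserving) satisfying $\Phi_v^{\theta,x}(Y)=\int_{-\infty}^{\infty}\gamma(t)\,e^{-i\tilde G_v^x(\theta)t}Ye^{i\tilde G_v^x(\theta)t}\,dt$ for every operator $Y$ on $v$. -/

import Mathlib

open scoped Matrix Kronecker ComplexOrder

namespace QCBM

/-! ### General notions for finite-dimensional quantum systems -/

/-- A (quantum) state: a positive semidefinite matrix of unit trace. -/
def IsState {ι : Type*} [Fintype ι] (ρ : Matrix ι ι ℂ) : Prop :=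
  ρ.PosSemidef ∧ ρ.trace = 1

/-- A positive operator-valued measure with outcomes `κ`. -/
def IsPOVM {ι κ : Type*} [Fintype ι] [DecidableEq ι] [Fintype κ]
    (L : κ → Matrix ι ι ℂ) : Prop :=
  (∀ x, (L x).PosSemidef) ∧ ∑ x, L x = 1

/-- A probability distribution on a finite set. -/
def IsProbDist {κ : Type*} [Fintype κ] (q : κ → ℝ) : Prop :=
  (∀ x, 0 ≤ q x) ∧ ∑ x, q x = 1

/-- A quantum channel: a linear, completely positive, trace-preserving map. Complete positivity
means that all the ampliations (the map applied to the blocks of a block matrix) are positive. -/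
def IsChannel {ι : Type*} [Fintype ι] (F : Matrix ι ι ℂ → Matrix ι ι ℂ) : Prop :=
  IsLinearMap ℂ F ∧
  (∀ (k : ℕ) (M : Matrix (ι × Fin k) (ι × Fin k) ℂ), M.PosSemidef →
    (Matrix.of fun p q : ι × Fin k =>
      F (Matrix.of fun i j => M (i, p.2) (j, q.2)) p.1 q.1).PosSemidef) ∧
  ∀ Y, (F Y).trace = Y.trace

/-- Partial trace over the second tensor factor. -/
def partialTrace {ι κ : Type*} [Fintype κ] (M : Matrix (ι × κ) (ι × κ) ℂ) : Matrix ι ι ℂ :=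
  Matrix.of fun i j => ∑ k, M (i, k) (j, k)

/-- The expectation `⟨A⟩_X = Tr[A X]`. -/
noncomputable def expval {ι : Type*} [Fintype ι] (A X : Matrix ι ι ℂ) : ℂ := (A * X).trace

/-- The rank-one operator `|ψ⟩⟨ψ|`. -/
def ketbra {κ : Type*} (ψ : EuclideanSpace ℂ κ) : Matrix κ κ ℂ :=
  Matrix.vecMulVec ψ.ofLp (star ψ.ofLp)

/-- The logarithm of a Hermitian matrix, by functional calculus (`0` is sent to `0`, so that
`ρ ln ρ` has its usual meaning for every state `ρ`). -/
noncomputable def matLog {ι : Type*} [Fintype ι] [DecidableEq ι] (A : Matrix ι ι ℂ) :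
    Matrix ι ι ℂ :=
  cfc Real.log A

/-- The power `A ^ z = exp (z ln A)` of a positive definite matrix, with complex exponent. -/
noncomputable def matPow {ι : Type*} [Fintype ι] [DecidableEq ι] (A : Matrix ι ι ℂ) (z : ℂ) :
    Matrix ι ι ℂ :=
  NormedSpace.exp (z • matLog A)

/-- The Umegaki relative entropy `D(ρ‖σ) = Tr[ρ ln ρ] - Tr[ρ ln σ]` of a state `ρ` with respect to
a positive definite state `σ`. See `relEntropy_coe`: taking the real part loses nothing. -/
noncomputable def relEntropy {ι : Type*} [Fintype ι] [DecidableEq ι] (ρ σ : Matrix ι ι ℂ) : ℝ :=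
  ((ρ * matLog ρ).trace - (ρ * matLog σ).trace).re

theorem relEntropy_coe {ι : Type*} [Fintype ι] [DecidableEq ι] {ρ : Matrix ι ι ℂ}
    (hρ : ρ.IsHermitian) (σ : Matrix ι ι ℂ) :
    (relEntropy ρ σ : ℂ) = (ρ * matLog ρ).trace - (ρ * matLog σ).trace := by
  have key : ∀ τ : Matrix ι ι ℂ, star (ρ * matLog τ).trace = (ρ * matLog τ).trace := by
    intro τ
    have h : (matLog τ)ᴴ = matLog τ := (cfc_predicate Real.log τ : IsSelfAdjoint _)
    rw [← Matrix.trace_conjTranspose, Matrix.conjTranspose_mul, h, hρ.eq, Matrix.trace_mul_comm]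
  have h2 : (starRingEnd ℂ) ((ρ * matLog ρ).trace - (ρ * matLog σ).trace) =
      (ρ * matLog ρ).trace - (ρ * matLog σ).trace := by
    rw [map_sub]
    exact congrArg₂ _ (key ρ) (key σ)
  exact Complex.conj_eq_iff_re.mp h2

/-- The thermal state `e^{-G} / Tr[e^{-G}]`. -/
noncomputable def thermal {ι : Type*} [Fintype ι] [DecidableEq ι] (G : Matrix ι ι ℂ) :
    Matrix ι ι ℂ :=
  (NormedSpace.exp (-G)).trace⁻¹ • NormedSpace.exp (-G)

/-- The high-peak tent probability density `γ(t) = (2/π) ln |coth (π t / 2)|`. -/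
noncomputable def tentDensity (t : ℝ) : ℝ :=
  2 / Real.pi * Real.log |Real.cosh (Real.pi * t / 2) / Real.sinh (Real.pi * t / 2)|

/-- The logistic probability density `β(t) = π / (2 (cosh (π t) + 1))`. -/
noncomputable def logisticDensity (t : ℝ) : ℝ :=
  Real.pi / (2 * (Real.cosh (Real.pi * t) + 1))

/-- `Φ_G(Y) = ∫ γ(t) e^{-iGt} Y e^{iGt} dt`, the integral being taken entrywise. -/
noncomputable def Phi {ι : Type*} [Fintype ι] [DecidableEq ι] (G Y : Matrix ι ι ℂ) :
    Matrix ι ι ℂ :=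
  Matrix.of fun i j => ∫ t : ℝ, (tentDensity t : ℂ) *
    (NormedSpace.exp ((-(Complex.I * t)) • G) * Y * NormedSpace.exp ((Complex.I * t) • G)) i j

/-- `Υ_σ(X) = ∫ β(t) σ^{-it/2} X σ^{it/2} dt`, the integral being taken entrywise. -/
noncomputable def Upsilon {ι : Type*} [Fintype ι] [DecidableEq ι] (σ X : Matrix ι ι ℂ) :
    Matrix ι ι ℂ :=
  Matrix.of fun i j => ∫ t : ℝ, (logisticDensity t : ℂ) *
    (matPow σ (-(Complex.I * t / 2)) * X * matPow σ (Complex.I * t / 2)) i j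

/-- `Ξ(R) = ½ {τ, σ^{-1/2} R σ^{-1/2}}`, with the anticommutator `{·,·}`. -/
noncomputable def Xi {ι : Type*} [Fintype ι] [DecidableEq ι] (τ σ R : Matrix ι ι ℂ) :
    Matrix ι ι ℂ :=
  (1 / 2 : ℂ) • (τ * (matPow σ (-1 / 2) * R * matPow σ (-1 / 2)) +
    (matPow σ (-1 / 2) * R * matPow σ (-1 / 2)) * τ)

/-! ### Restricted quantum–classical Boltzmann machines -/

/-- The Hamiltonian
`G(θ) = ∑ᵢ aᵢ Vᵢ ⊗ I + I ⊗ ∑ⱼ bⱼ Hⱼ + ∑ᵢⱼ wᵢⱼ Vᵢ ⊗ Hⱼ` of a restricted machine. -/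
noncomputable def hamiltonian {ι κ : Type*} [DecidableEq ι] [DecidableEq κ] {m n : ℕ}
    (V : Fin m → Matrix ι ι ℂ) (H : Fin n → Matrix κ κ ℂ)
    (a : Fin m → ℝ) (b : Fin n → ℝ) (w : Fin m → Fin n → ℝ) : Matrix (ι × κ) (ι × κ) ℂ :=
  ∑ i, (a i : ℂ) • (V i ⊗ₖ (1 : Matrix κ κ ℂ)) +
    (1 : Matrix ι ι ℂ) ⊗ₖ (∑ j, (b j : ℂ) • H j) +
    ∑ i, ∑ j, (w i j : ℂ) • (V i ⊗ₖ H j)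

/-- The visible state `σ_v(θ) = Tr_h[e^{-G(θ)} / Tr[e^{-G(θ)}]]`. -/
noncomputable def visibleState {ι κ : Type*} [Fintype ι] [DecidableEq ι] [Fintype κ]
    [DecidableEq κ] {m n : ℕ} (V : Fin m → Matrix ι ι ℂ) (H : Fin n → Matrix κ κ ℂ)
    (a : Fin m → ℝ) (b : Fin n → ℝ) (w : Fin m → Fin n → ℝ) : Matrix ι ι ℂ :=
  partialTrace (thermal (hamiltonian V H a b w))

/-- `G̃_v^x(θ) = ∑ᵢ (aᵢ + ∑ⱼ wᵢⱼ h_{j,x}) Vᵢ`. -/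
noncomputable def condHamiltonianTilde {ι κ : Type*} {m n : ℕ}
    (V : Fin m → Matrix ι ι ℂ) (h : Fin n → κ → ℝ)
    (a : Fin m → ℝ) (w : Fin m → Fin n → ℝ) (x : κ) : Matrix ι ι ℂ :=
  ∑ i, ((a i + ∑ j, w i j * h j x : ℝ) : ℂ) • V i

/-- `G_v^x(θ) = ∑ⱼ bⱼ h_{j,x} I + ∑ᵢ (aᵢ + ∑ⱼ wᵢⱼ h_{j,x}) Vᵢ`. -/
noncomputable def condHamiltonian {ι κ : Type*} [DecidableEq ι] {m n : ℕ}
    (V : Fin m → Matrix ι ι ℂ) (h : Fin n → κ → ℝ)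
    (a : Fin m → ℝ) (b : Fin n → ℝ) (w : Fin m → Fin n → ℝ) (x : κ) : Matrix ι ι ℂ :=
  ((∑ j, b j * h j x : ℝ) : ℂ) • (1 : Matrix ι ι ℂ) +
    ∑ i, ((a i + ∑ j, w i j * h j x : ℝ) : ℂ) • V i

/-- `σ_v^x(θ) = e^{-G_v^x(θ)} / Tr[e^{-G_v^x(θ)}]`. -/
noncomputable def condState {ι κ : Type*} [Fintype ι] [DecidableEq ι] {m n : ℕ}
    (V : Fin m → Matrix ι ι ℂ) (h : Fin n → κ → ℝ)
    (a : Fin m → ℝ) (b : Fin n → ℝ) (w : Fin m → Fin n → ℝ) (x : κ) : Matrix ι ι ℂ :=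
  thermal (condHamiltonian V h a b w x)

/-- `p_x(θ) = Tr[e^{-G_v^x(θ)}] / Tr[e^{-G(θ)}]`. Both traces are real. -/
noncomputable def p {ι κ : Type*} [Fintype ι] [DecidableEq ι] [Fintype κ] [DecidableEq κ]
    {m n : ℕ} (V : Fin m → Matrix ι ι ℂ) (H : Fin n → Matrix κ κ ℂ) (h : Fin n → κ → ℝ)
    (a : Fin m → ℝ) (b : Fin n → ℝ) (w : Fin m → Fin n → ℝ) (x : κ) : ℝ :=
  (NormedSpace.exp (-condHamiltonian V h a b w x)).trace.re /
    (NormedSpace.exp (-hamiltonian V H a b w)).trace.re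

/-- `Σ_v^{θ,x} = Φ_v^{θ,x} ∘ Ξ_v^{θ,x} ∘ Υ_v^θ`. -/
noncomputable def SigmaMap {ι κ : Type*} [Fintype ι] [DecidableEq ι] [Fintype κ] [DecidableEq κ]
    {m n : ℕ} (V : Fin m → Matrix ι ι ℂ) (H : Fin n → Matrix κ κ ℂ) (h : Fin n → κ → ℝ)
    (a : Fin m → ℝ) (b : Fin n → ℝ) (w : Fin m → Fin n → ℝ) (x : κ) (R : Matrix ι ι ℂ) :
    Matrix ι ι ℂ :=
  Phi (condHamiltonian V h a b w x)
    (Xi (condState V h a b w x) (visibleState V H a b w)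
      (Upsilon (visibleState V H a b w) R))

/-- `Λ_x(θ) = Υ_v^θ(σ_v(θ)^{-1/2} p_x(θ) σ_v^x(θ) σ_v(θ)^{-1/2})`. -/
noncomputable def Lambda {ι κ : Type*} [Fintype ι] [DecidableEq ι] [Fintype κ] [DecidableEq κ]
    {m n : ℕ} (V : Fin m → Matrix ι ι ℂ) (H : Fin n → Matrix κ κ ℂ) (h : Fin n → κ → ℝ)
    (a : Fin m → ℝ) (b : Fin n → ℝ) (w : Fin m → Fin n → ℝ) (x : κ) : Matrix ι ι ℂ :=
  Upsilon (visibleState V H a b w)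
    (matPow (visibleState V H a b w) (-1 / 2) *
      ((p V H h a b w x : ℂ) • condState V h a b w x) *
      matPow (visibleState V H a b w) (-1 / 2))

/-- `q_x(θ) = Tr[Λ_x(θ) ρ]`, as a real number; the trace is real since `Λ_x(θ)` and `ρ` are
Hermitian. -/
noncomputable def q {ι κ : Type*} [Fintype ι] [DecidableEq ι] [Fintype κ] [DecidableEq κ]
    {m n : ℕ} (V : Fin m → Matrix ι ι ℂ) (H : Fin n → Matrix κ κ ℂ) (h : Fin n → κ → ℝ)
    (a : Fin m → ℝ) (b : Fin n → ℝ) (w : Fin m → Fin n → ℝ) (ρ : Matrix ι ι ℂ) (x : κ) : ℝ :=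
  (Lambda V H h a b w x * ρ).trace.re

end QCBM

/-! ### The two probability densities and their Fourier transforms -/

namespace QCBM
open MeasureTheory Set

/-! In a joint eigenbasis of the `H j` the Hamiltonian is block diagonal, `G = ∑ₓ Gˣ ⊗ |x⟩⟨x|`.
Hence `e^{-G} = ∑ₓ e^{-Gˣ} ⊗ |x⟩⟨x|`, and the visible state is the mixture `Z⁻¹ ∑ₓ e^{-Gˣ} = ∑ₓ pₓ
σˣ` (`visibleState_eq`). What remains is to differentiate `Tr[ρ ln σ]` along a mixture of thermal
states (`hasDerivAt_relEntropy_thermalMixture`).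

Two derivative formulas carry this: `d e^{-G} = -½ {e^{-G}, Φ_G(dG)}` and `d ln σ = Υ_σ(σ^{-1/2} dσ
σ^{-1/2})`. In an eigenbasis a twirl `∫ f(t) e^{-iAt} X e^{iAt} dt` multiplies entries by the
Fourier transform of `f` at differences of eigenvalues, so both formulas reduce to scalar divided
differences of `exp`. They hold because the transform of `γ` is `tanh(ω/2)/(ω/2)`
(`fourierDensity_tent_mul`) and that of `β` is `ω/sinh ω` (`fourierDensity_logistic_mul_sinh`).

No perturbation theory of eigenvalues is needed. With different generators on the two sides of the
twirl, the formulas become exact identities for `e^{-A} - e^{-B}` and `A - B`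
(`exp_neg_sub_exp_neg`, `sub_eq_twirl_exp_sub_exp`), checked entrywise with rows in an eigenbasis of
`A` and columns in one of `B`. Dividing by the increment and using dominated convergence gives the
derivatives.

Both densities are even, so `Φ` and `Υ` are self-adjoint for the trace pairing and can be moved from
the perturbation onto `ρ`; this produces `Σ`. The derivative of `Z` gives the model term, since `Φ`
fixes `e^{-Gˣ}`. For `b j` the perturbation is the scalar `h_{j,x}`, and `pₓ Tr[Σˣ(ρ)] = qₓ`. The
POVM property follows because `Υ` is positive and unital and `σ^{-1/2} (∑ₓ pₓ σˣ) σ^{-1/2} = 1`. -/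

/-- The Fourier transform `∫ f(t) e^{-iωt} dt` of a real density. -/
noncomputable def fourierDensity (f : ℝ → ℝ) (ω : ℝ) : ℂ :=
  ∫ t : ℝ, (f t : ℂ) * Complex.exp (-(Complex.I * t * ω))

lemma fourierDensity_zero (f : ℝ → ℝ) : fourierDensity f 0 = ((∫ t, f t : ℝ) : ℂ) := by
  simp [fourierDensity, integral_complex_ofReal]

/-! ### The logistic density -/

lemma logisticDensity_nonneg (t : ℝ) : 0 ≤ logisticDensity t := by
  unfold logisticDensity
  have := Real.cosh_pos (Real.pi * t)
  positivity

lemma logisticDensity_neg (t : ℝ) : logisticDensity (-t) = logisticDensity t := by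
  simp [logisticDensity]

lemma logisticDensity_eq_sigmoid (t : ℝ) :
    logisticDensity t =
      Real.sigmoid (Real.pi * t) * (1 - Real.sigmoid (Real.pi * t)) * Real.pi := by
  rw [← Real.sigmoid_neg]
  simp only [logisticDensity, Real.sigmoid_def, Real.cosh_eq, neg_neg]
  have h1 := Real.exp_pos (Real.pi * t)
  have h2 := Real.exp_pos (-(Real.pi * t))
  have h3 : Real.exp (Real.pi * t) * Real.exp (-(Real.pi * t)) = 1 := by
    rw [← Real.exp_add]; simp
  field_simp
  linear_combination h3

lemma hasDerivAt_sigmoid_pi_mul (t : ℝ) :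
    HasDerivAt (fun t => Real.sigmoid (Real.pi * t)) (logisticDensity t) t := by
  rw [logisticDensity_eq_sigmoid]
  have h := (Real.hasDerivAt_sigmoid (Real.pi * t)).comp t
    ((hasDerivAt_id t).const_mul Real.pi)
  simpa only [Function.comp_def, mul_one] using h

lemma image_sigmoid_pi_mul : (fun t => Real.sigmoid (Real.pi * t)) '' univ = Ioo 0 1 := by
  rw [image_univ, ← Real.range_sigmoid]
  exact (mul_left_surjective₀ Real.pi_ne_zero).range_comp Real.sigmoid

lemma injOn_sigmoid_pi_mul : InjOn (fun t => Real.sigmoid (Real.pi * t)) univ :=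
  (Real.sigmoid_injective.comp (mul_right_injective₀ Real.pi_ne_zero)).injOn

/-- The cumulative distribution function of `β` is `sigmoid (π t)`, so the substitution `u = sigmoid
(π t)` turns `β(t) dt` into Lebesgue measure on the unit interval. -/
lemma integral_logisticDensity_mul (g : ℝ → ℂ) :
    ∫ t, (logisticDensity t : ℂ) * g (Real.sigmoid (Real.pi * t)) = ∫ x in (0 : ℝ)..1, g x := by
  have h := integral_image_eq_integral_abs_deriv_smul (s := univ) MeasurableSet.univ
    (fun t _ => (hasDerivAt_sigmoid_pi_mul t).hasDerivWithinAt) injOn_sigmoid_pi_mul g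
  rw [image_sigmoid_pi_mul, setIntegral_univ] at h
  rw [intervalIntegral.integral_of_le zero_le_one, integral_Ioc_eq_integral_Ioo, h]
  simp [abs_of_nonneg (logisticDensity_nonneg _)]

lemma integral_logisticDensity : ∫ t, logisticDensity t = 1 := by
  have h := integral_logisticDensity_mul fun _ => 1
  simp only [mul_one, integral_complex_ofReal] at h
  simpa using h

lemma integrable_logisticDensity : Integrable logisticDensity :=
  -- The Bochner integral of a non-integrable function is `0`, so a nonzero value certifies
  -- integrability.
  .of_integral_ne_zero (by rw [integral_logisticDensity]; exact one_ne_zero)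

lemma sigmoid_cpow (x : ℝ) (s : ℂ) :
    (Real.sigmoid x : ℂ) ^ s * (1 - (Real.sigmoid x : ℂ)) ^ (-s) = Complex.exp (s * x) := by
  have h0 : 0 < Real.sigmoid x := Real.sigmoid_pos x
  have h1 : 0 < Real.sigmoid (-x) := Real.sigmoid_pos (-x)
  have e : (1 - (Real.sigmoid x : ℂ)) = ((Real.sigmoid (-x) : ℝ) : ℂ) := by
    rw [Real.sigmoid_neg]; push_cast; rfl
  rw [e, Complex.cpow_def_of_ne_zero (by exact_mod_cast h0.ne'),
    Complex.cpow_def_of_ne_zero (by exact_mod_cast h1.ne'), ← Complex.exp_add,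
    ← Complex.ofReal_log h0.le, ← Complex.ofReal_log h1.le]
  have h2 : Real.log (Real.sigmoid (-x)) = Real.log (Real.sigmoid x) - x := by
    rw [← Real.sigmoid_mul_rexp_neg, Real.log_mul h0.ne' (Real.exp_pos _).ne', Real.log_exp]
    ring
  rw [h2]
  push_cast
  ring_nf

/-- With `u = sigmoid (π t)` one has `u/(1-u) = e^{πt}`, so `e^{-iωt} = u^s (1-u)^{-s}` for `s =
-iω/π`. The transform is therefore the Beta integral `B(1+s, 1-s) = s Γ(s) Γ(1-s) = πs / sin(πs)`,
by the reflection formula. The product form avoids division at `ω = 0`. -/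
lemma fourierDensity_logistic_mul_sinh (ω : ℝ) :
    fourierDensity logisticDensity ω * Real.sinh ω = ω := by
  rcases eq_or_ne ω 0 with rfl | hω
  · simp
  set s : ℂ := -(Complex.I * ω / Real.pi) with hs
  have hpi : (Real.pi : ℂ) ≠ 0 := by exact_mod_cast Real.pi_ne_zero
  have hωc : (ω : ℂ) ≠ 0 := by exact_mod_cast hω
  have hs0 : s ≠ 0 := by
    simp [hs, hωc, hpi]
  have h1 : fourierDensity logisticDensity ω = Complex.betaIntegral (1 + s) (1 - s) := by
    rw [Complex.betaIntegral, ← integral_logisticDensity_mul, fourierDensity]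
    refine integral_congr_ae (.of_forall fun t => ?_)
    simp only
    rw [show 1 + s - 1 = s by ring, show 1 - s - 1 = -s by ring, sigmoid_cpow]
    congr 2
    rw [hs]
    push_cast
    field_simp
  have hre : s.re = 0 := by
    have : s = ((-(ω / Real.pi) : ℝ) : ℂ) * Complex.I := by rw [hs]; push_cast; ring
    rw [this, Complex.re_ofReal_mul]; simp
  have h2 := Complex.Gamma_mul_Gamma_eq_betaIntegral (s := 1 + s) (t := 1 - s)
    (by simp [hre]) (by simp [hre])
  rw [show 1 + s + (1 - s) = 2 by ring, ← h1, add_comm 1 s, Complex.Gamma_add_one s hs0, mul_assoc,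
    Complex.Gamma_mul_Gamma_one_sub] at h2
  have h3 : Complex.sin (Real.pi * s) = -(Real.sinh ω * Complex.I) := by
    have : (Real.pi : ℂ) * s = -(ω * Complex.I) := by rw [hs]; field_simp
    rw [this, Complex.sin_neg, Complex.sin_mul_I, Complex.ofReal_sinh]
  have h4 : (Real.sinh ω : ℂ) ≠ 0 := by exact_mod_cast (Real.sinh_ne_zero.2 hω)
  have h5 : Complex.Gamma 2 = 1 := by
    have := Complex.Gamma_nat_eq_factorial 1
    rw [Nat.cast_one, one_add_one_eq_two] at this
    simp
  rw [h3, h5, one_mul] at h2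
  rw [← h2, hs]
  have := Complex.I_ne_zero
  field_simp

/-! ### The tent density -/

lemma tentDensity_neg (t : ℝ) : tentDensity (-t) = tentDensity t := by
  simp only [tentDensity, mul_neg, neg_div, Real.cosh_neg, Real.sinh_neg, div_neg, abs_neg]

lemma tentDensity_nonneg (t : ℝ) : 0 ≤ tentDensity t := by
  unfold tentDensity
  rcases eq_or_ne t 0 with rfl | ht
  · simp
  refine mul_nonneg (by positivity) (Real.log_nonneg ?_)
  have h : 0 < |Real.sinh (Real.pi * t / 2)| := by
    rw [abs_pos, Real.sinh_ne_zero]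
    have := Real.pi_ne_zero
    positivity
  rw [abs_div, one_le_div h, Real.abs_sinh, abs_of_pos (Real.cosh_pos _), ← Real.cosh_abs]
  exact (Real.sinh_lt_cosh _).le

/-- With `x = e^{-πt}`, `coth(πt/2) = (1+x)/(1-x)`; this is the odd power series of `log(1+x) -
log(1-x)`. -/
lemma tentDensity_hasSum {t : ℝ} (ht : 0 < t) :
    HasSum (fun k : ℕ => 4 / Real.pi * (1 / (2 * k + 1)) *
      Real.exp (-((2 * k + 1) * Real.pi) * t)) (tentDensity t) := by
  have hpt : 0 < Real.pi * t := by positivity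
  have hx0 := Real.exp_pos (-(Real.pi * t))
  have hx1 : Real.exp (-(Real.pi * t)) < 1 := by simpa using hpt
  have h := (Real.hasSum_log_sub_log_of_abs_lt_one
    (x := Real.exp (-(Real.pi * t))) (by rwa [abs_of_pos hx0])).mul_left (2 / Real.pi)
  convert! h using 1
  · ext k
    rw [← Real.exp_nat_mul, show ((2 * k + 1 : ℕ) : ℝ) * -(Real.pi * t) =
      -((2 * k + 1) * Real.pi) * t by push_cast; ring]
    ring
  · rw [tentDensity, ← Real.log_div (by linarith) (by linarith)]
    congr 2
    rw [Real.cosh_eq, Real.sinh_eq]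
    have e : Real.exp (-(Real.pi * t)) =
        Real.exp (-(Real.pi * t / 2)) * Real.exp (-(Real.pi * t / 2)) := by
      rw [← Real.exp_add]; ring_nf
    have e2 : Real.exp (Real.pi * t / 2) * Real.exp (-(Real.pi * t / 2)) = 1 := by
      rw [← Real.exp_add]; simp
    have hlt : Real.exp (-(Real.pi * t / 2)) < Real.exp (Real.pi * t / 2) :=
      Real.exp_lt_exp.2 (by linarith)
    have hy := Real.exp_pos (-(Real.pi * t / 2))
    rw [abs_of_pos (div_pos (by positivity) (by linarith)), e] at *
    set y := Real.exp (-(Real.pi * t / 2))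
    set z := Real.exp (Real.pi * t / 2)
    rw [div_div_div_cancel_right₀ two_ne_zero, div_eq_div_iff (by linarith) (by nlinarith)]
    linear_combination (-2 * y) * e2

lemma hasSum_integral_tentDensity_Ioi (ω : ℝ) :
    HasSum (fun k : ℕ => 4 / (Real.pi : ℂ) * (1 / (2 * k + 1)) *
      (1 / ((2 * k + 1) * Real.pi + Complex.I * ω)))
      (∫ t in Ioi (0 : ℝ), (tentDensity t : ℂ) * Complex.exp (-(Complex.I * t * ω))) := by
  have hre : ∀ k : ℕ, (-((2 * k + 1) * (Real.pi : ℂ) + Complex.I * ω)).re < 0 := by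
    intro k
    have : (-((2 * k + 1) * (Real.pi : ℂ) + Complex.I * ω)) =
      ((-((2 * k + 1) * Real.pi) : ℝ) : ℂ) + ((-ω : ℝ) : ℂ) * Complex.I := by push_cast; ring
    rw [this, Complex.add_re, Complex.re_ofReal_mul, Complex.ofReal_re]
    simp only [Complex.I_re, mul_zero, add_zero]
    have := Real.pi_pos
    have : 0 < (2 * (k : ℝ) + 1) * Real.pi := by positivity
    linarith
  set F : ℕ → ℝ → ℂ := fun k t => 4 / (Real.pi : ℂ) * (1 / (2 * k + 1)) *
    Complex.exp (-((2 * k + 1) * (Real.pi : ℂ) + Complex.I * ω) * t) with hF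
  have hnorm : ∀ k t, ‖F k t‖ = 4 / Real.pi * (1 / (2 * k + 1)) *
      Real.exp (-((2 * k + 1) * Real.pi) * t) := by
    intro k t
    have e1 : -((2 * k + 1) * (Real.pi : ℂ) + Complex.I * ω) * t =
      ((-((2 * k + 1) * Real.pi) * t : ℝ) : ℂ) + ((-ω * t : ℝ) : ℂ) * Complex.I := by
      push_cast; ring
    have e2 : 4 / (Real.pi : ℂ) * (1 / (2 * k + 1)) =
      ((4 / Real.pi * (1 / (2 * k + 1)) : ℝ) : ℂ) := by push_cast; ring
    have h0 : 0 ≤ 4 / Real.pi * (1 / (2 * (k : ℝ) + 1)) := by have := Real.pi_pos; positivity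
    rw [hF]
    simp only
    rw [norm_mul, e1, e2, Complex.exp_add, norm_mul, Complex.norm_exp_ofReal_mul_I,
      Complex.norm_real, Real.norm_of_nonneg h0, ← Complex.ofReal_exp, Complex.norm_real,
      Real.norm_of_nonneg (Real.exp_pos _).le, mul_one]
  have hint : ∀ k, IntegrableOn (F k) (Ioi 0) := fun k =>
    (integrableOn_exp_mul_complex_Ioi (hre k) 0).const_mul _
  -- The `k`-th norm integrates to `4/(π²(2k+1)²)`, which justifies termwise integration.
  have hsum : Summable fun k => ∫ t in Ioi (0 : ℝ), ‖F k t‖ := by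
    have : ∀ k : ℕ, ∫ t in Ioi (0 : ℝ), ‖F k t‖ =
        4 / Real.pi ^ 2 * (1 / ((2 * k + 1 : ℕ) : ℝ) ^ 2) := by
      intro k
      have hp := Real.pi_pos
      have hneg : -((2 * (k : ℝ) + 1) * Real.pi) < 0 := by
        have : 0 < (2 * (k : ℝ) + 1) * Real.pi := by positivity
        linarith
      simp_rw [hnorm]
      rw [integral_const_mul, integral_exp_mul_Ioi hneg]
      push_cast
      simp only [mul_zero, Real.exp_zero]
      field_simp
    simp_rw [this]
    refine Summable.mul_left _ ?_
    exact (Real.summable_one_div_nat_pow.2 one_lt_two).comp_injective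
      (i := fun k : ℕ => 2 * k + 1) (fun a b h => by simpa using h)
  have h := hasSum_integral_of_summable_integral_norm hint hsum
  convert! h using 1
  · ext k
    rw [hF]
    simp only
    rw [integral_const_mul, integral_exp_mul_complex_Ioi (hre k)]
    simp only [Complex.ofReal_zero, mul_zero, Complex.exp_zero, neg_div_neg_eq]
  · refine setIntegral_congr_fun measurableSet_Ioi fun t ht => ?_
    have h1 := (Complex.hasSum_ofReal.2 (tentDensity_hasSum ht)).mul_right
      (Complex.exp (-(Complex.I * t * ω)))
    rw [← h1.tsum_eq]
    refine tsum_congr fun k => ?_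
    rw [hF]
    push_cast
    rw [mul_assoc, ← Complex.exp_add]
    ring_nf

/-- At `ω = 0` the termwise formula makes the integral a sum of positive terms, hence nonzero, which
rules out non-integrability. -/
lemma integrableOn_tentDensity_Ioi : IntegrableOn tentDensity (Ioi 0) := by
  refine .of_integral_ne_zero fun h0 => ?_
  have h := hasSum_integral_tentDensity_Ioi 0
  simp only [Complex.ofReal_zero, mul_zero, neg_zero, Complex.exp_zero, mul_one, add_zero] at h
  rw [integral_complex_ofReal, h0] at h
  have h' : HasSum (fun k : ℕ => 4 / Real.pi * (1 / (2 * k + 1)) *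
      (1 / ((2 * k + 1) * Real.pi))) 0 := by
    rw [← Complex.hasSum_ofReal]
    simpa using h
  have hpos : ∀ k : ℕ, 0 < 4 / Real.pi * (1 / (2 * (k : ℝ) + 1)) *
      (1 / ((2 * k + 1) * Real.pi)) := fun k => by
    have := Real.pi_pos
    positivity
  have := (hasSum_zero_iff_of_nonneg fun k => (hpos k).le).1 h'
  exact (hpos 0).ne' (congrFun this 0)

lemma integrable_tentDensity : Integrable tentDensity := by
  rw [← integrableOn_univ, ← Iic_union_Ioi (a := (0 : ℝ)), integrableOn_union]
  refine ⟨?_, integrableOn_tentDensity_Ioi⟩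
  have h := integrableOn_tentDensity_Ioi
  rw [integrableOn_Iic_iff_integrableOn_Iio]
  rw [← neg_zero] at h
  have := h.comp_neg_Iio
  simpa [tentDensity_neg] using this

lemma fourierDensity_tent_hasSum (ω : ℝ) :
    HasSum (fun k : ℕ => 8 / ((2 * k + 1) ^ 2 * (Real.pi : ℂ) ^ 2 + ω ^ 2))
      (fourierDensity tentDensity ω) := by
  have hI : Integrable fun t : ℝ => (tentDensity t : ℂ) * Complex.exp (-(Complex.I * t * ω)) := by
    refine integrable_tentDensity.ofReal.mul_bdd (c := 1) (by fun_prop) (.of_forall fun t => ?_)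
    rw [show -(Complex.I * t * ω) = ((-(t * ω) : ℝ) : ℂ) * Complex.I by push_cast; ring,
      Complex.norm_exp_ofReal_mul_I]
  have h1 := hasSum_integral_tentDensity_Ioi ω
  have h2 := hasSum_integral_tentDensity_Ioi (-ω)
  -- As `γ` is even, the negative half-line contributes the half-line integral at `-ω`; conjugate
  -- fractions then combine to real ones.
  have e : fourierDensity tentDensity ω =
      (∫ t in Ioi (0 : ℝ), (tentDensity t : ℂ) * Complex.exp (-(Complex.I * t * ω))) +
      ∫ t in Ioi (0 : ℝ), (tentDensity t : ℂ) * Complex.exp (-(Complex.I * t * (-ω : ℝ))) := by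
    rw [fourierDensity, ← intervalIntegral.integral_Iic_add_Ioi hI.integrableOn hI.integrableOn
      (b := 0), add_comm]
    congr 1
    rw [← neg_zero, ← integral_comp_neg_Ioi]
    simp [tentDensity_neg]
  rw [e]
  convert! h1.add h2 using 1
  ext k
  have hp : (0 : ℝ) < (2 * k + 1) * Real.pi := by have := Real.pi_pos; positivity
  have n1 : ∀ x : ℝ, ((2 * k + 1) * (Real.pi : ℂ) + Complex.I * x) ≠ 0 := by
    intro x hx
    have := congrArg Complex.re hx
    rw [show ((2 * k + 1) * (Real.pi : ℂ) + Complex.I * x) =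
      (((2 * k + 1) * Real.pi : ℝ) : ℂ) + (x : ℂ) * Complex.I by push_cast; ring,
      Complex.add_re, Complex.re_ofReal_mul, Complex.ofReal_re] at this
    simp only [Complex.I_re, mul_zero, add_zero, Complex.zero_re] at this
    exact hp.ne' this
  have n2 := n1 ω
  have n3 := n1 (-ω)
  have n4 : (2 * (k : ℂ) + 1) ≠ 0 := by
    have : ((2 * k + 1 : ℕ) : ℂ) ≠ 0 := Nat.cast_ne_zero.2 (by omega)
    simpa using this
  have n5 : (Real.pi : ℂ) ≠ 0 := by exact_mod_cast Real.pi_ne_zero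
  have e1 : (2 * (k : ℂ) + 1) ^ 2 * (Real.pi : ℂ) ^ 2 + ω ^ 2 =
      ((2 * k + 1) * (Real.pi : ℂ) + Complex.I * ω) *
      ((2 * k + 1) * (Real.pi : ℂ) + Complex.I * (-ω : ℝ)) := by
    push_cast
    linear_combination ((ω : ℂ) ^ 2) * Complex.I_sq
  rw [e1]
  generalize hA : ((2 * k + 1) * (Real.pi : ℂ) + Complex.I * ω) = A at *
  generalize hB : ((2 * k + 1) * (Real.pi : ℂ) + Complex.I * (-ω : ℝ)) = B at *
  have hAB : A + B = 2 * ((2 * k + 1) * Real.pi) := by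
    rw [← hA, ← hB]; push_cast; ring
  field_simp
  linear_combination (-4) * hAB

lemma summable_one_div_sq_add_sq (y : ℝ) : Summable fun n : ℕ => 1 / (y ^ 2 + (n : ℝ) ^ 2) := by
  -- At `n = 0` the bound `1/n²` is `1/0 = 0`, so that term is dominated by a separate finitely
  -- supported summand.
  refine Summable.of_nonneg_of_le (fun n => by positivity) (fun n => ?_)
    ((Real.summable_one_div_nat_pow.2 one_lt_two).add
      (summable_of_ne_finset_zero (s := {0}) (f := fun n : ℕ => if n = 0 then 1 / y ^ 2 else 0)
        fun n hn => by simp_all))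
  rcases eq_or_ne n 0 with rfl | hn
  · simp
  · have : 0 < (n : ℝ) := by positivity
    simp only [hn, if_false, add_zero]
    gcongr
    nlinarith [sq_nonneg y]

/-- This is the partial fraction expansion of `π cot(πz)` at `z = iy`. The term `n = 0` contributes
`2/y`, which turns `-1/y` into `+1/y`. -/
lemma mul_tsum_one_div_sq_add_sq {y : ℝ} (hy : y ≠ 0) :
    2 * y * ∑' n : ℕ, 1 / (y ^ 2 + (n : ℝ) ^ 2) =
      Real.pi * (Real.cosh (Real.pi * y) / Real.sinh (Real.pi * y)) + 1 / y := by
  have hI : (Complex.I * y) ∈ Complex.integerComplement := by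
    rw [Complex.mem_integerComplement_iff]
    rintro ⟨n, hn⟩
    have := congrArg Complex.im hn
    simp at this
    exact hy this.symm
  have hyc : (y : ℂ) ≠ 0 := by exact_mod_cast hy
  have h := cot_series_rep' hI
  have h1 : (Real.pi : ℂ) * (Complex.I * y) = ((Real.pi * y : ℝ) : ℂ) * Complex.I := by
    push_cast; ring
  have hs : (Real.sinh (Real.pi * y) : ℂ) ≠ 0 := by
    exact_mod_cast Real.sinh_ne_zero.2 (mul_ne_zero Real.pi_ne_zero hy)
  have h2 : Complex.cot (Real.pi * (Complex.I * y)) =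
      -(Complex.I * (Real.cosh (Real.pi * y) / Real.sinh (Real.pi * y) : ℝ)) := by
    rw [Complex.cot, h1, Complex.cos_mul_I, Complex.sin_mul_I, Complex.ofReal_div,
      Complex.ofReal_cosh, Complex.ofReal_sinh] at *
    have := Complex.I_ne_zero
    field_simp
    linear_combination Complex.cosh (Real.pi * y : ℝ) * Complex.I_sq
  have h3 : ∀ n : ℕ, 1 / (Complex.I * y - (n + 1)) + 1 / (Complex.I * y + (n + 1)) =
      -(2 * (Complex.I * y)) * ((1 / (y ^ 2 + ((n + 1 : ℕ) : ℝ) ^ 2) : ℝ) : ℂ) := by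
    intro n
    have e1 := cotTerm_identity hI n
    rw [cotTerm] at e1
    rw [e1]
    have e2 : (Complex.I * y + (n + 1)) * (Complex.I * y - (n + 1)) =
      -(((y ^ 2 + ((n + 1 : ℕ) : ℝ) ^ 2 : ℝ)) : ℂ) := by
      push_cast
      linear_combination (y : ℂ) ^ 2 * Complex.I_sq
    rw [e2, Complex.ofReal_div, Complex.ofReal_one, div_neg]
    ring
  rw [tsum_congr h3, tsum_mul_left, ← Complex.ofReal_tsum, h2] at h
  rw [(summable_one_div_sq_add_sq y).tsum_eq_zero_add]
  set S := ∑' n : ℕ, 1 / (y ^ 2 + ((n + 1 : ℕ) : ℝ) ^ 2) with hS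
  set c := Real.cosh (Real.pi * y) / Real.sinh (Real.pi * y)
  have key : ((2 * y * S : ℝ) : ℂ) = ((Real.pi * c - 1 / y : ℝ) : ℂ) := by
    push_cast
    have hII : 1 / (Complex.I * y) = -(Complex.I * (1 / y)) := by
      have := Complex.I_ne_zero
      field_simp
      linear_combination Complex.I_sq
    rw [hII] at h
    refine mul_left_cancel₀ (neg_ne_zero.2 Complex.I_ne_zero) ?_
    linear_combination -h
  have key' := Complex.ofReal_injective key
  simp only [Nat.cast_zero]
  rw [mul_add, key']
  field_simp
  ring

/-- The odd terms are all terms minus the even ones, and the even ones are a quarter of the same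
series at `y/2`. -/
lemma hasSum_one_div_sq_add_odd_sq (y : ℝ) :
    HasSum (fun k : ℕ => 1 / (y ^ 2 + (2 * (k : ℝ) + 1) ^ 2))
      ((∑' n : ℕ, 1 / (y ^ 2 + (n : ℝ) ^ 2)) -
        1 / 4 * ∑' n : ℕ, 1 / ((y / 2) ^ 2 + (n : ℝ) ^ 2)) := by
  set f : ℕ → ℝ := fun n => 1 / (y ^ 2 + (n : ℝ) ^ 2) with hf
  have hs : Summable f := summable_one_div_sq_add_sq y
  have he : ∀ k : ℕ, f (2 * k) = 1 / 4 * (1 / ((y / 2) ^ 2 + (k : ℝ) ^ 2)) := by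
    intro k
    simp only [hf]
    push_cast
    rw [show y ^ 2 + (2 * (k : ℝ)) ^ 2 = 4 * ((y / 2) ^ 2 + (k : ℝ) ^ 2) by ring,
      one_div_mul_one_div]
  have ho : ∀ k : ℕ, f (2 * k + 1) = 1 / (y ^ 2 + (2 * (k : ℝ) + 1) ^ 2) := by
    intro k
    simp only [hf]
    push_cast
    rfl
  have hse : Summable fun k => f (2 * k) := by
    simp_rw [he]
    exact (summable_one_div_sq_add_sq _).mul_left _
  have hso : Summable fun k => f (2 * k + 1) := hs.comp_injective fun a b h => by simpa using h
  have h := tsum_even_add_odd hse hso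
  simp_rw [he] at h
  rw [tsum_mul_left] at h
  rw [← h, add_sub_cancel_left]
  simp_rw [← ho]
  exact hso.hasSum

lemma fourierDensity_tent_eq (ω : ℝ) :
    fourierDensity tentDensity ω = ((8 / Real.pi ^ 2 *
      ((∑' n : ℕ, 1 / ((ω / Real.pi) ^ 2 + (n : ℝ) ^ 2)) -
        1 / 4 * ∑' n : ℕ, 1 / ((ω / Real.pi / 2) ^ 2 + (n : ℝ) ^ 2)) : ℝ) : ℂ) := by
  refine (fourierDensity_tent_hasSum ω).unique ?_
  have h := (hasSum_one_div_sq_add_odd_sq (ω / Real.pi)).mul_left (8 / Real.pi ^ 2)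
  rw [← Complex.hasSum_ofReal] at h
  convert! h using 1
  ext k
  have hpi := Real.pi_ne_zero
  rw [show 8 / Real.pi ^ 2 * (1 / ((ω / Real.pi) ^ 2 + (2 * (k : ℝ) + 1) ^ 2)) =
    8 / ((2 * k + 1) ^ 2 * Real.pi ^ 2 + ω ^ 2) by
      rw [div_mul_div_comm, mul_one]
      congr 1
      field_simp
      ring]
  push_cast
  rfl

lemma integral_tentDensity : ∫ t, tentDensity t = 1 := by
  have h := fourierDensity_tent_eq 0
  rw [fourierDensity_zero] at h
  have h' := Complex.ofReal_injective h
  -- Here the `n = 0` term is `1/0 = 0`, so the series is that of `ζ(2)`.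
  have hz : ∑' n : ℕ, 1 / ((0 : ℝ) ^ 2 + (n : ℝ) ^ 2) = Real.pi ^ 2 / 6 := by
    rw [← hasSum_zeta_two.tsum_eq]
    simp
  rw [h', zero_div, zero_div, hz]
  have := Real.pi_ne_zero
  field_simp
  norm_num

/-- In the difference of the two series the `1/y` terms cancel, leaving `coth(2u) - ½ coth u = ½
tanh u` with `u = ω/2`. -/
lemma fourierDensity_tent_mul (ω : ℝ) :
    fourierDensity tentDensity ω * (ω * Real.cosh (ω / 2)) = 2 * Real.sinh (ω / 2) := by
  rcases eq_or_ne ω 0 with rfl | hω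
  · simp
  have hpi := Real.pi_ne_zero
  have hy : ω / Real.pi ≠ 0 := div_ne_zero hω hpi
  have h1 := mul_tsum_one_div_sq_add_sq hy
  have h2 := mul_tsum_one_div_sq_add_sq (div_ne_zero hy two_ne_zero)
  set S := ∑' n : ℕ, 1 / ((ω / Real.pi) ^ 2 + (n : ℝ) ^ 2)
  set T := ∑' n : ℕ, 1 / ((ω / Real.pi / 2) ^ 2 + (n : ℝ) ^ 2)
  rw [show Real.pi * (ω / Real.pi) = 2 * (ω / 2) by field_simp, Real.cosh_two_mul,
    Real.sinh_two_mul] at h1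
  rw [show Real.pi * (ω / Real.pi / 2) = ω / 2 by field_simp] at h2
  have hs : Real.sinh (ω / 2) ≠ 0 := Real.sinh_ne_zero.2 (div_ne_zero hω two_ne_zero)
  have hc : Real.cosh (ω / 2) ≠ 0 := (Real.cosh_pos _).ne'
  set s := Real.sinh (ω / 2)
  set c := Real.cosh (ω / 2)
  have h3 : 2 * (ω / Real.pi) * (S - 1 / 4 * T) = Real.pi / 2 * (s / c) := by
    have : 2 * (ω / Real.pi) * (S - 1 / 4 * T) =
      2 * (ω / Real.pi) * S - 1 / 2 * (2 * (ω / Real.pi / 2) * T) := by ring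
    rw [this, h1, h2]
    field_simp
    ring
  have h4 : 8 / Real.pi ^ 2 * (S - 1 / 4 * T) * (ω * c) =
      4 / Real.pi * c * (2 * (ω / Real.pi) * (S - 1 / 4 * T)) := by
    field_simp
    ring
  rw [h3] at h4
  rw [fourierDensity_tent_eq, ← Complex.ofReal_mul, ← Complex.ofReal_mul, h4, ← Complex.ofReal_ofNat,
    ← Complex.ofReal_mul]
  congr 1
  field_simp
  ring
end QCBM

/-! ### Twirls by one-parameter unitary groups -/

namespace QCBM
open MeasureTheory Set Filter Topology NormedSpace
open scoped Matrix.Norms.L2Operator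

lemma posSemidef_smul {ι : Type*} {c : ℝ} (hc : 0 ≤ c) {M : Matrix ι ι ℂ} (hM : M.PosSemidef) :
    ((c : ℂ) • M).PosSemidef := hM.smul (by exact_mod_cast hc)

lemma kronecker_one_conj_apply {ι κ : Type*} [Fintype ι] [Fintype κ] [DecidableEq κ] (U W : Matrix ι ι ℂ)
    (M : Matrix (ι × κ) (ι × κ) ℂ) (p q : ι × κ) :
    ((U ⊗ₖ (1 : Matrix κ κ ℂ)) * M * (W ⊗ₖ (1 : Matrix κ κ ℂ))) p q =
      (U * (Matrix.of fun i j => M (i, p.2) (j, q.2)) * W) p.1 q.1 := by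
  simp [Matrix.mul_apply, Fintype.sum_prod_type, Matrix.one_apply, Finset.sum_mul]

variable {ι : Type*} [Fintype ι] [DecidableEq ι]

lemma exp_mul_exp_neg (A : Matrix ι ι ℂ) : exp A * exp (-A) = 1 := by
  rw [← Matrix.exp_add_of_commute _ _ (Commute.refl A).neg_right, add_neg_cancel, exp_zero]

lemma exp_neg_mul_exp (A : Matrix ι ι ℂ) : exp (-A) * exp A = 1 := by
  simpa using exp_mul_exp_neg (-A)

lemma conjTranspose_exp_I_smul {A : Matrix ι ι ℂ} (hA : A.IsHermitian) (t : ℝ) :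
    (exp ((Complex.I * t) • A))ᴴ = exp ((-(Complex.I * t)) • A) := by
  rw [← Matrix.exp_conjTranspose, Matrix.conjTranspose_smul, hA.eq]
  simp

lemma conjTranspose_exp_neg_I_smul {A : Matrix ι ι ℂ} (hA : A.IsHermitian) (t : ℝ) :
    (exp ((-(Complex.I * t)) • A))ᴴ = exp ((Complex.I * t) • A) := by
  rw [← conjTranspose_exp_I_smul hA, Matrix.conjTranspose_conjTranspose]

lemma exp_I_smul_mem_unitary {A : Matrix ι ι ℂ} (hA : A.IsHermitian) (t : ℝ) :
    exp ((Complex.I * t) • A) ∈ unitary (Matrix ι ι ℂ) := by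
  rw [Unitary.mem_iff, Matrix.star_eq_conjTranspose, conjTranspose_exp_I_smul hA, neg_smul]
  exact ⟨exp_neg_mul_exp _, exp_mul_exp_neg _⟩

lemma norm_le_one_of_mem_unitary {U : Matrix ι ι ℂ} (hU : U ∈ unitary (Matrix ι ι ℂ)) :
    ‖U‖ ≤ 1 := by
  cases isEmpty_or_nonempty ι
  · simp [Subsingleton.elim U 0]
  · exact (CStarRing.norm_of_mem_unitary hU).le

lemma norm_exp_I_smul_le {A : Matrix ι ι ℂ} (hA : A.IsHermitian) (t : ℝ) :
    ‖exp ((Complex.I * t) • A)‖ ≤ 1 :=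
  norm_le_one_of_mem_unitary (exp_I_smul_mem_unitary hA t)

lemma norm_exp_neg_I_smul_le {A : Matrix ι ι ℂ} (hA : A.IsHermitian) (t : ℝ) :
    ‖exp ((-(Complex.I * t)) • A)‖ ≤ 1 := by
  simpa using norm_exp_I_smul_le hA (-t)

/-- The twirl `∫ f(t) e^{-iAt} X e^{iBt} dt`, the integral being taken entrywise. -/
noncomputable def twirl (f : ℝ → ℝ) (A B X : Matrix ι ι ℂ) : Matrix ι ι ℂ :=
  Matrix.of fun i j => ∫ t : ℝ, (f t : ℂ) *
    (exp ((-(Complex.I * t)) • A) * X * exp ((Complex.I * t) • B)) i j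

lemma Phi_eq_twirl (G Y : Matrix ι ι ℂ) : Phi G Y = twirl tentDensity G G Y := rfl

lemma Upsilon_eq_twirl (σ X : Matrix ι ι ℂ) : Upsilon σ X =
    twirl logisticDensity ((1 / 2 : ℂ) • matLog σ) ((1 / 2 : ℂ) • matLog σ) X := by
  unfold Upsilon twirl matPow
  simp only [smul_smul, mul_one_div, neg_div]

variable {f : ℝ → ℝ} {A B : Matrix ι ι ℂ}

lemma continuous_exp_smul (A : Matrix ι ι ℂ) : Continuous fun z : ℂ => exp (z • A) :=
  let : NormedAlgebra ℚ (Matrix ι ι ℂ) := NormedAlgebra.restrictScalars ℚ ℂ _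
  NormedSpace.exp_continuous.comp (continuous_id.smul continuous_const)

lemma continuous_twirl_integrand (A B X : Matrix ι ι ℂ) : Continuous fun t : ℝ =>
    exp ((-(Complex.I * t)) • A) * X * exp ((Complex.I * t) • B) := by
  have h1 := (continuous_exp_smul A).comp
    (show Continuous fun t : ℝ => (-(Complex.I * (t : ℂ))) by fun_prop)
  have h2 := (continuous_exp_smul B).comp
    (show Continuous fun t : ℝ => Complex.I * (t : ℂ) by fun_prop)
  exact (h1.mul continuous_const).mul h2

lemma norm_twirl_integrand_le (hA : A.IsHermitian) (hB : B.IsHermitian) (X : Matrix ι ι ℂ) (t : ℝ) :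
    ‖exp ((-(Complex.I * t)) • A) * X * exp ((Complex.I * t) • B)‖ ≤ ‖X‖ := by
  calc _ ≤ ‖exp ((-(Complex.I * t)) • A)‖ * ‖X‖ * ‖exp ((Complex.I * t) • B)‖ := by
        refine (norm_mul_le _ _).trans ?_
        gcongr
        exact norm_mul_le _ _
    _ ≤ 1 * ‖X‖ * 1 := by
        gcongr
        · exact norm_exp_neg_I_smul_le hA t
        · exact norm_exp_I_smul_le hB t
    _ = ‖X‖ := by ring

lemma integrable_twirl_integrand (hf : Integrable f) (hA : A.IsHermitian) (hB : B.IsHermitian)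
    (X : Matrix ι ι ℂ) : Integrable fun t : ℝ =>
      (f t : ℂ) • (exp ((-(Complex.I * t)) • A) * X * exp ((Complex.I * t) • B)) :=
  (hf.ofReal (𝕜 := ℂ)).smul_bdd ‖X‖ (continuous_twirl_integrand A B X).aestronglyMeasurable
    (.of_forall (norm_twirl_integrand_le hA hB X))

lemma matrix_integral_apply {F : ℝ → Matrix ι ι ℂ} (hF : Integrable F) (i j : ι) :
    (∫ t, F t) i j = ∫ t, F t i j :=
  ((Matrix.entryLinearMap ℂ ℂ i j).toContinuousLinearMap.integral_comp_comm hF).symm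

/-- Links the entrywise definition to the Bochner integral, where linear maps, positivity and limits
pass through. Integrability holds because unitary conjugation keeps the norm at most `‖X‖`. -/
lemma twirl_eq_integral (hf : Integrable f) (hA : A.IsHermitian) (hB : B.IsHermitian)
    (X : Matrix ι ι ℂ) : twirl f A B X = ∫ t : ℝ,
      (f t : ℂ) • (exp ((-(Complex.I * t)) • A) * X * exp ((Complex.I * t) • B)) := by
  ext i j
  rw [matrix_integral_apply (integrable_twirl_integrand hf hA hB X)]
  rfl

lemma isLinearMap_twirl (hf : Integrable f) (hA : A.IsHermitian) (hB : B.IsHermitian) :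
    IsLinearMap ℂ (twirl f A B) where
  map_add X Y := by
    simp only [twirl_eq_integral hf hA hB]
    rw [← integral_add (integrable_twirl_integrand hf hA hB X)
      (integrable_twirl_integrand hf hA hB Y)]
    simp only [mul_add, add_mul, smul_add]
  map_smul c X := by
    simp only [twirl_eq_integral hf hA hB]
    rw [← integral_smul]
    simp only [Matrix.mul_smul, Matrix.smul_mul, smul_comm c]

lemma linearMap_twirl (hf : Integrable f) (hA : A.IsHermitian) (hB : B.IsHermitian)
    (φ : Matrix ι ι ℂ →ₗ[ℂ] ℂ) (X : Matrix ι ι ℂ) :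
    φ (twirl f A B X) = ∫ t : ℝ,
      (f t : ℂ) * φ (exp ((-(Complex.I * t)) • A) * X * exp ((Complex.I * t) • B)) := by
  rw [twirl_eq_integral hf hA hB]
  have := φ.toContinuousLinearMap.integral_comp_comm (integrable_twirl_integrand hf hA hB X)
  simp only [LinearMap.coe_toContinuousLinearMap', map_smul, smul_eq_mul] at this
  exact this.symm

/-- Cyclicity of the trace moves the conjugation from `X` to `R` with the sign of `t` reversed, and
the evenness of `f` absorbs the reversal. -/
lemma trace_mul_twirl (hf : Integrable f) (hA : A.IsHermitian) (heven : ∀ t, f (-t) = f t)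
    (R X : Matrix ι ι ℂ) : (R * twirl f A A X).trace = (twirl f A A R * X).trace := by
  have h1 := linearMap_twirl hf hA hA
    (Matrix.traceLinearMap ι ℂ ℂ ∘ₗ LinearMap.mulLeft ℂ R) X
  have h2 := linearMap_twirl hf hA hA
    (Matrix.traceLinearMap ι ℂ ℂ ∘ₗ LinearMap.mulRight ℂ X) R
  simp only [LinearMap.comp_apply, LinearMap.mulLeft_apply, LinearMap.mulRight_apply,
    Matrix.traceLinearMap_apply] at h1 h2
  rw [h1, h2, ← integral_neg_eq_self]
  refine integral_congr_ae (.of_forall fun t => ?_)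
  simp only [heven, Complex.ofReal_neg, mul_neg, neg_neg]
  congr 1
  rw [← mul_assoc, Matrix.trace_mul_comm]
  simp only [mul_assoc]

lemma twirl_one (f : ℝ → ℝ) (A : Matrix ι ι ℂ) :
    twirl f A A 1 = ((∫ t, f t : ℝ) : ℂ) • 1 := by
  ext i j
  simp only [twirl, mul_one, neg_smul, exp_neg_mul_exp, Matrix.of_apply, Matrix.smul_apply,
    smul_eq_mul]
  rw [integral_mul_const, integral_complex_ofReal]

lemma trace_twirl (hf : Integrable f) (hA : A.IsHermitian) (heven : ∀ t, f (-t) = f t)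
    (X : Matrix ι ι ℂ) : (twirl f A A X).trace = ((∫ t, f t : ℝ) : ℂ) * X.trace := by
  rw [← one_mul (twirl f A A X), trace_mul_twirl hf hA heven, twirl_one, Matrix.smul_mul, one_mul,
    Matrix.trace_smul, smul_eq_mul]

/-! ### Positivity -/

/-- Integrability is not needed: otherwise the integral is `0`, which is positive semidefinite. -/
lemma posSemidef_integral {F : ℝ → Matrix ι ι ℂ} (hpos : ∀ t, (F t).PosSemidef) :
    (∫ t, F t).PosSemidef := by
  open scoped MatrixOrder in
  rw [← Matrix.nonneg_iff_posSemidef]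
  exact integral_nonneg fun t => (hpos t).nonneg

lemma posSemidef_twirl (hf : Integrable f) (hpos : ∀ t, 0 ≤ f t) (hA : A.IsHermitian)
    {X : Matrix ι ι ℂ} (hX : X.PosSemidef) : (twirl f A A X).PosSemidef := by
  rw [twirl_eq_integral hf hA hA]
  refine posSemidef_integral fun t => posSemidef_smul (hpos t) ?_
  rw [← conjTranspose_exp_neg_I_smul hA]
  exact hX.mul_mul_conjTranspose_same _

lemma exp_kronecker_one {κ : Type*} [Fintype κ] [DecidableEq κ] (A : Matrix ι ι ℂ) :
    exp (A ⊗ₖ (1 : Matrix κ κ ℂ)) = exp A ⊗ₖ (1 : Matrix κ κ ℂ) := by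
  rw [Matrix.kronecker_one, Matrix.kronecker_one, Matrix.exp_blockDiagonal]
  congr 1
  let : NormedAlgebra ℚ (Matrix ι ι ℂ) := NormedAlgebra.restrictScalars ℚ ℂ _
  exact funext (Pi.coe_exp (fun _ : κ => A))

/-- An ampliation of the twirl by `A` is the twirl by `A ⊗ 1`, so complete positivity reduces to
positivity. -/
lemma isChannel_twirl (hf : Integrable f) (hpos : ∀ t, 0 ≤ f t) (heven : ∀ t, f (-t) = f t)
    (hone : ∫ t, f t = 1) (hA : A.IsHermitian) : IsChannel (twirl f A A) := by
  refine ⟨isLinearMap_twirl hf hA hA, fun k M hM => ?_, fun Y => ?_⟩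
  · have hA' : (A ⊗ₖ (1 : Matrix (Fin k) (Fin k) ℂ)).IsHermitian := by
      rw [Matrix.IsHermitian, Matrix.conjTranspose_kronecker, hA.eq, Matrix.conjTranspose_one]
    convert! posSemidef_twirl hf hpos hA' hM using 1
    ext p q
    simp only [twirl, Matrix.of_apply, ← Matrix.smul_kronecker, exp_kronecker_one,
      kronecker_one_conj_apply]
  · rw [trace_twirl hf hA heven, hone, Complex.ofReal_one, one_mul]
end QCBM

/-! ### Mixed eigenbases and exact difference formulas -/

namespace QCBM
open MeasureTheory Set Filter Topology NormedSpace
open scoped Matrix.Norms.L2Operator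

lemma isHermitian_half_smul {ι : Type*} {A : Matrix ι ι ℂ} (hA : A.IsHermitian) : ((1 / 2 : ℂ) • A).IsHermitian := by
  rw [Matrix.IsHermitian, Matrix.conjTranspose_smul, hA.eq]
  simp

variable {ι : Type*} [Fintype ι] [DecidableEq ι]

/-- `A = U diag(a) Uᴴ` with `U` unitary. -/
structure IsDiagonalizedBy (A U : Matrix ι ι ℂ) (a : ι → ℝ) : Prop where
  conjTranspose_mul_self : Uᴴ * U = 1
  self_mul_conjTranspose : U * Uᴴ = 1
  eq : A = U * Matrix.diagonal (fun i => (a i : ℂ)) * Uᴴ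

lemma exists_isDiagonalizedBy {A : Matrix ι ι ℂ} (hA : A.IsHermitian) :
    ∃ U a, IsDiagonalizedBy A U a := by
  refine ⟨hA.eigenvectorUnitary, hA.eigenvalues, Unitary.coe_star_mul_self _,
    Unitary.coe_mul_star_self _, ?_⟩
  conv_lhs => rw [hA.spectral_theorem, Unitary.conjStarAlgAut_apply]
  rfl

namespace IsDiagonalizedBy

variable {A B U W : Matrix ι ι ℂ} {a b : ι → ℝ}

lemma exp_smul (h : IsDiagonalizedBy A U a) (z : ℂ) :
    exp (z • A) = U * Matrix.diagonal (fun i => Complex.exp (z * a i)) * Uᴴ := by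
  have h1 := Matrix.exp_units_conj ⟨U, Uᴴ, h.self_mul_conjTranspose, h.conjTranspose_mul_self⟩
    (Matrix.diagonal fun i => z * (a i : ℂ))
  have h2 : exp (Matrix.diagonal fun i => z * (a i : ℂ)) =
      Matrix.diagonal fun i => Complex.exp (z * a i) := by
    rw [Matrix.exp_diagonal]
    congr 1
    ext i
    rw [Pi.coe_exp, Complex.exp_eq_exp_ℂ]
  rw [h2] at h1
  refine Eq.trans ?_ h1
  congr 1
  conv_lhs => rw [h.eq]
  have : (Matrix.diagonal fun i => z * (a i : ℂ)) = z • Matrix.diagonal fun i => (a i : ℂ) := by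
    rw [← Matrix.diagonal_smul]; rfl
  simp [this]

lemma conjTranspose_mul (h : IsDiagonalizedBy A U a) :
    Uᴴ * A = Matrix.diagonal (fun i => (a i : ℂ)) * Uᴴ := by
  conv_lhs => rw [h.eq]
  rw [← mul_assoc, ← mul_assoc, h.conjTranspose_mul_self, one_mul]

lemma mul_self (h : IsDiagonalizedBy A U a) :
    A * U = U * Matrix.diagonal (fun i => (a i : ℂ)) := by
  conv_lhs => rw [h.eq]
  rw [mul_assoc, h.conjTranspose_mul_self, mul_one]

lemma conjTranspose_mul_exp (h : IsDiagonalizedBy A U a) (z : ℂ) :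
    Uᴴ * exp (z • A) = Matrix.diagonal (fun i => Complex.exp (z * a i)) * Uᴴ := by
  rw [h.exp_smul, ← mul_assoc, ← mul_assoc, h.conjTranspose_mul_self, one_mul]

lemma exp_mul_self (h : IsDiagonalizedBy A U a) (z : ℂ) :
    exp (z • A) * U = U * Matrix.diagonal (fun i => Complex.exp (z * a i)) := by
  rw [h.exp_smul, mul_assoc, h.conjTranspose_mul_self, mul_one]

/-- In the mixed coordinates `Uᴴ M W`, left multiplication by `A` or its exponentials scales rows,
and right multiplication by `B` or its exponentials scales columns. Matrix identities thus become
scalar ones in `a i` and `b j`. -/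
lemma mul_apply (hA : IsDiagonalizedBy A U a) (M : Matrix ι ι ℂ) (i j : ι) :
    (Uᴴ * (A * M) * W) i j = a i * (Uᴴ * M * W) i j := by
  rw [← mul_assoc, hA.conjTranspose_mul, mul_assoc, mul_assoc, Matrix.diagonal_mul, mul_assoc]

lemma apply_mul (hB : IsDiagonalizedBy B W b) (M : Matrix ι ι ℂ) (i j : ι) :
    (Uᴴ * (M * B) * W) i j = (Uᴴ * M * W) i j * b j := by
  rw [mul_assoc, mul_assoc, hB.mul_self, ← mul_assoc, ← mul_assoc, Matrix.mul_diagonal]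

lemma exp_mul_apply (hA : IsDiagonalizedBy A U a) (z : ℂ) (M : Matrix ι ι ℂ) (i j : ι) :
    (Uᴴ * (exp (z • A) * M) * W) i j = Complex.exp (z * a i) * (Uᴴ * M * W) i j := by
  rw [← mul_assoc, hA.conjTranspose_mul_exp, mul_assoc, mul_assoc, Matrix.diagonal_mul, mul_assoc]

lemma mul_exp_apply (hB : IsDiagonalizedBy B W b) (z : ℂ) (M : Matrix ι ι ℂ) (i j : ι) :
    (Uᴴ * (M * exp (z • B)) * W) i j = (Uᴴ * M * W) i j * Complex.exp (z * b j) := by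
  rw [mul_assoc, mul_assoc, hB.exp_mul_self, ← mul_assoc, ← mul_assoc, Matrix.mul_diagonal]

lemma ext_apply (hA : IsDiagonalizedBy A U a) (hB : IsDiagonalizedBy B W b) {M N : Matrix ι ι ℂ}
    (h : ∀ i j, (Uᴴ * M * W) i j = (Uᴴ * N * W) i j) : M = N := by
  have h1 : Uᴴ * M * W = Uᴴ * N * W := Matrix.ext h
  have h2 : ∀ K : Matrix ι ι ℂ, U * (Uᴴ * K * W) * Wᴴ = K := fun K => by
    rw [← mul_assoc, ← mul_assoc, hA.self_mul_conjTranspose, one_mul, mul_assoc,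
      hB.self_mul_conjTranspose, mul_one]
  rw [← h2 M, h1, h2]

lemma twirl_apply {f : ℝ → ℝ} (hf : Integrable f) (hA' : A.IsHermitian) (hB' : B.IsHermitian)
    (hA : IsDiagonalizedBy A U a) (hB : IsDiagonalizedBy B W b) (X : Matrix ι ι ℂ) (i j : ι) :
    (Uᴴ * twirl f A B X * W) i j = fourierDensity f (a i - b j) * (Uᴴ * X * W) i j := by
  have h := linearMap_twirl hf hA' hB' (Matrix.entryLinearMap ℂ ℂ i j ∘ₗ
    LinearMap.mulRight ℂ W ∘ₗ LinearMap.mulLeft ℂ Uᴴ) X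
  simp only [LinearMap.comp_apply, LinearMap.mulLeft_apply, LinearMap.mulRight_apply,
    Matrix.entryLinearMap_apply] at h
  rw [h, fourierDensity, ← integral_mul_const]
  refine integral_congr_ae (.of_forall fun t => ?_)
  simp only
  rw [hB.mul_exp_apply, hA.exp_mul_apply]
  rw [show -(Complex.I * t * ((a i - b j : ℝ) : ℂ)) =
    (-(Complex.I * t)) * a i + Complex.I * t * b j by push_cast; ring, Complex.exp_add]
  ring

lemma half_smul (h : IsDiagonalizedBy A U a) :
    IsDiagonalizedBy ((1 / 2 : ℂ) • A) U fun i => a i / 2 where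
  conjTranspose_mul_self := h.conjTranspose_mul_self
  self_mul_conjTranspose := h.self_mul_conjTranspose
  eq := by
    have : (Matrix.diagonal fun i => ((a i / 2 : ℝ) : ℂ)) =
        (1 / 2 : ℂ) • Matrix.diagonal fun i => (a i : ℂ) := by
      rw [← Matrix.diagonal_smul]
      congr 1
      ext i
      simp [div_eq_inv_mul]
    rw [this, Matrix.mul_smul, Matrix.smul_mul, ← h.eq]

end IsDiagonalizedBy

/-- This is `e^{-x} - e^{-y} = -(e^{-x} + e^{-y}) tanh((x-y)/2)`, with `tanh` supplied by the
transform of `γ`. -/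
lemma exp_sub_exp_eq_fourierDensity_tent (x y : ℝ) :
    Complex.exp (-x) - Complex.exp (-y) = -1 / 2 *
      ((Complex.exp (-x) + Complex.exp (-y)) *
        (fourierDensity tentDensity (x - y) * (x - y))) := by
  have h := fourierDensity_tent_mul (x - y)
  have hx : Complex.exp (-x) = Complex.exp (-x / 2) * Complex.exp (-x / 2) := by
    rw [← Complex.exp_add]; ring_nf
  have hy : Complex.exp (-y) = Complex.exp (-y / 2) * Complex.exp (-y / 2) := by
    rw [← Complex.exp_add]; ring_nf
  have h1 : Complex.exp (((x - y) / 2 : ℝ) : ℂ) * Complex.exp (-x / 2) = Complex.exp (-y / 2) := by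
    rw [← Complex.exp_add]; push_cast; ring_nf
  have h2 : Complex.exp (-(((x - y) / 2 : ℝ) : ℂ)) * Complex.exp (-y / 2) =
      Complex.exp (-x / 2) := by
    rw [← Complex.exp_add]; push_cast; ring_nf
  rw [Complex.ofReal_cosh, Complex.ofReal_sinh, Complex.cosh, Complex.sinh] at h
  rw [hx, hy]
  push_cast at h h1 h2 ⊢
  -- What is left is polynomial algebra modulo `u p = q` and `v q = p`.
  generalize Complex.exp ((x - y) / 2 : ℂ) = u at *
  generalize Complex.exp (-((x - y) / 2) : ℂ) = v at *
  generalize Complex.exp (-x / 2 : ℂ) = p at *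
  generalize Complex.exp (-y / 2 : ℂ) = q at *
  generalize fourierDensity tentDensity (x - y) = F at *
  linear_combination (p * q) * h -
    (F * (x - y) / 2 - 1) * q * h1 - (F * (x - y) / 2 + 1) * p * h2

/-- The bracket equals `2 sinh((x-y)/2)`. The transform of `β` is therefore needed at half the
difference, which is why `Υ` carries the exponents `it/2`. -/
lemma sub_eq_fourierDensity_logistic (x y : ℝ) :
    (x - y : ℂ) = fourierDensity logisticDensity (x / 2 - y / 2) *
      (Complex.exp (-1 / 2 * x) * ((Complex.exp x - Complex.exp y) * Complex.exp (-1 / 2 * y))) := by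
  have h := fourierDensity_logistic_mul_sinh (x / 2 - y / 2)
  rw [Complex.ofReal_sinh, Complex.sinh] at h
  have h1 : Complex.exp (-1 / 2 * x) * ((Complex.exp x - Complex.exp y) *
      Complex.exp (-1 / 2 * y)) = Complex.exp ((x / 2 - y / 2 : ℝ) : ℂ) -
        Complex.exp (-((x / 2 - y / 2 : ℝ) : ℂ)) := by
    simp only [mul_sub, sub_mul, ← Complex.exp_add]
    push_cast
    ring_nf
  rw [h1]
  push_cast at h ⊢
  linear_combination -2 * h

variable {A B : Matrix ι ι ℂ}

/-- An exact identity, with no commutation assumed: in mixed coordinates `A - B` has entries `(a i -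
b j) (Uᴴ W) i j`, and the left side has `e^{-a i} - e^{-b j}` in place of `a i - b j`. -/
lemma exp_neg_sub_exp_neg (hA : A.IsHermitian) (hB : B.IsHermitian) :
    exp (-A) - exp (-B) = (-1 / 2 : ℂ) • (exp (-A) * twirl tentDensity A B (A - B) +
      twirl tentDensity A B (A - B) * exp (-B)) := by
  obtain ⟨U, a, hU⟩ := exists_isDiagonalizedBy hA
  obtain ⟨W, b, hW⟩ := exists_isDiagonalizedBy hB
  refine hU.ext_apply hW fun i j => ?_
  rw [← neg_one_smul ℂ A, ← neg_one_smul ℂ B]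
  have e1 := hU.exp_mul_apply (W := W) (-1) 1 i j
  have e2 := hW.mul_exp_apply (U := U) (-1) 1 i j
  have e3 := hU.mul_apply (W := W) 1 i j
  have e4 := hW.apply_mul (U := U) 1 i j
  rw [mul_one, mul_one] at e1 e3
  rw [one_mul, mul_one] at e2 e4
  have e5 : (Uᴴ * (A - B) * W) i j = (a i - b j) * (Uᴴ * W) i j := by
    rw [mul_sub, sub_mul, Matrix.sub_apply, e3, e4]; ring
  rw [mul_sub, sub_mul, Matrix.sub_apply, e1, e2, Matrix.mul_smul, Matrix.smul_mul,
    Matrix.smul_apply, mul_add, add_mul, Matrix.add_apply, hU.exp_mul_apply, hW.mul_exp_apply,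
    hU.twirl_apply integrable_tentDensity hA hB hW, e5]
  have key := exp_sub_exp_eq_fourierDensity_tent (a i) (b j)
  rw [neg_one_mul, neg_one_mul, smul_eq_mul]
  linear_combination (Uᴴ * W) i j * key

lemma sub_eq_twirl_exp_sub_exp (hA : A.IsHermitian) (hB : B.IsHermitian) :
    A - B = twirl logisticDensity ((1 / 2 : ℂ) • A) ((1 / 2 : ℂ) • B)
      (exp ((-1 / 2 : ℂ) • A) * ((exp A - exp B) * exp ((-1 / 2 : ℂ) • B))) := by
  obtain ⟨U, a, hU⟩ := exists_isDiagonalizedBy hA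
  obtain ⟨W, b, hW⟩ := exists_isDiagonalizedBy hB
  refine hU.ext_apply hW fun i j => ?_
  have e1 := hU.exp_mul_apply (W := W) 1 1 i j
  have e2 := hW.mul_exp_apply (U := U) 1 1 i j
  have e3 := hU.mul_apply (W := W) 1 i j
  have e4 := hW.apply_mul (U := U) 1 i j
  rw [mul_one, mul_one] at e3
  rw [one_smul, one_mul, mul_one, mul_one] at e1
  rw [one_mul, mul_one] at e4
  rw [one_smul, one_mul, one_mul, mul_one] at e2
  rw [hU.half_smul.twirl_apply integrable_logisticDensity (isHermitian_half_smul hA)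
    (isHermitian_half_smul hB) hW.half_smul, hU.exp_mul_apply, hW.mul_exp_apply, mul_sub, sub_mul,
    Matrix.sub_apply, e3, e4, mul_sub, sub_mul, Matrix.sub_apply, e1, e2]
  linear_combination (Uᴴ * W) i j * sub_eq_fourierDensity_logistic (a i) (b j)

/-! ### Derivatives of the matrix exponential and logarithm along curves -/

/-- Dominated convergence: the exponentials are unitary, so `|f| (‖Y‖ + 1)` eventually dominates
whatever the moving generator `C s` is. -/
lemma tendsto_twirl {f : ℝ → ℝ} (hf : Integrable f) {α : Type*} {l : Filter α}
    [l.IsCountablyGenerated] {C X : α → Matrix ι ι ℂ} {Y : Matrix ι ι ℂ}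
    (hC : ∀ s, (C s).IsHermitian) (hA : A.IsHermitian) (hB : B.IsHermitian)
    (hCA : Tendsto C l (𝓝 A)) (hX : Tendsto X l (𝓝 Y)) :
    Tendsto (fun s => twirl f (C s) B (X s)) l (𝓝 (twirl f A B Y)) := by
  simp only [twirl_eq_integral hf hA hB, fun s => twirl_eq_integral hf (hC s) hB (X s)]
  have hb : ∀ᶠ s in l, ‖X s‖ ≤ ‖Y‖ + 1 :=
    (hX.norm.eventually_lt_const (lt_add_one _)).mono fun _ h => h.le
  refine tendsto_integral_filter_of_dominated_convergence (fun t => ‖f t‖ * (‖Y‖ + 1))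
    (.of_forall fun s => (integrable_twirl_integrand hf (hC s) hB (X s)).aestronglyMeasurable)
    (hb.mono fun s hs => .of_forall fun t => ?_) (hf.norm.mul_const _) (.of_forall fun t => ?_)
  · rw [norm_smul, Complex.norm_real]
    gcongr
    exact (norm_twirl_integrand_le (hC s) hB (X s) t).trans hs
  · let : NormedAlgebra ℚ (Matrix ι ι ℂ) := NormedAlgebra.restrictScalars ℚ ℂ _
    have h1 : Tendsto (fun s => exp ((-(Complex.I * t)) • C s)) l
        (𝓝 (exp ((-(Complex.I * t)) • A))) :=
      (NormedSpace.exp_continuous.tendsto _).comp (hCA.const_smul _)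
    exact ((h1.mul hX).mul_const _).const_smul _

/-- The exact difference formula, divided by `s - s₀`, expresses the slope of `e^{-G}` through the
slope of `G` inside a twirl; `tendsto_twirl` then passes to the limit. -/
lemma hasDerivAt_exp_neg {G : ℝ → Matrix ι ι ℂ} {K : Matrix ι ι ℂ} {s₀ : ℝ}
    (hG : ∀ s, (G s).IsHermitian) (h : HasDerivAt G K s₀) :
    HasDerivAt (fun s => exp (-G s)) ((-1 / 2 : ℂ) • (exp (-G s₀) * Phi (G s₀) K +
      Phi (G s₀) K * exp (-G s₀))) s₀ := by
  rw [Phi_eq_twirl]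
  have hc : Tendsto G (𝓝[≠] s₀) (𝓝 (G s₀)) := h.continuousAt.tendsto.mono_left nhdsWithin_le_nhds
  have hs := hasDerivAt_iff_tendsto_slope.1 h
  rw [hasDerivAt_iff_tendsto_slope]
  have ht := tendsto_twirl integrable_tentDensity hG (hG s₀) (hG s₀) hc hs
  let : NormedAlgebra ℚ (Matrix ι ι ℂ) := NormedAlgebra.restrictScalars ℚ ℂ _
  have he : Tendsto (fun s => exp (-G s)) (𝓝[≠] s₀) (𝓝 (exp (-G s₀))) :=
    (NormedSpace.exp_continuous.tendsto _).comp hc.neg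
  refine (((he.mul ht).add (ht.mul_const _)).const_smul (-1 / 2 : ℂ)).congr fun s => ?_
  rw [slope_def_module, slope_def_module, exp_neg_sub_exp_neg (hG s) (hG s₀),
    ← Complex.coe_smul, ← Complex.coe_smul,
    (isLinearMap_twirl integrable_tentDensity (hG s) (hG s₀)).map_smul, Matrix.mul_smul,
    Matrix.smul_mul, ← smul_add, smul_comm]

/-- The reverse direction: continuity of `L` is enough, because the exact formula recovers the slope
of `L` from that of `e^L`. It is applied to `L = ln σ`. -/
lemma hasDerivAt_of_hasDerivAt_exp {L : ℝ → Matrix ι ι ℂ} {D : Matrix ι ι ℂ} {s₀ : ℝ}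
    (hL : ∀ s, (L s).IsHermitian) (hc : ContinuousAt L s₀)
    (h : HasDerivAt (fun s => exp (L s)) D s₀) :
    HasDerivAt L (twirl logisticDensity ((1 / 2 : ℂ) • L s₀) ((1 / 2 : ℂ) • L s₀)
      (exp ((-1 / 2 : ℂ) • L s₀) * (D * exp ((-1 / 2 : ℂ) • L s₀)))) s₀ := by
  have hc' : Tendsto L (𝓝[≠] s₀) (𝓝 (L s₀)) := hc.tendsto.mono_left nhdsWithin_le_nhds
  have hs := hasDerivAt_iff_tendsto_slope.1 h
  rw [hasDerivAt_iff_tendsto_slope]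
  let : NormedAlgebra ℚ (Matrix ι ι ℂ) := NormedAlgebra.restrictScalars ℚ ℂ _
  have he : Tendsto (fun s => exp ((-1 / 2 : ℂ) • L s)) (𝓝[≠] s₀)
      (𝓝 (exp ((-1 / 2 : ℂ) • L s₀))) :=
    (NormedSpace.exp_continuous.tendsto _).comp (hc'.const_smul _)
  have ht := tendsto_twirl integrable_logisticDensity (fun s => isHermitian_half_smul (hL s))
    (isHermitian_half_smul (hL s₀)) (isHermitian_half_smul (hL s₀)) (hc'.const_smul _)
    (he.mul (hs.mul_const (exp ((-1 / 2 : ℂ) • L s₀))))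
  refine ht.congr fun s => ?_
  rw [slope_def_module, slope_def_module, ← Complex.coe_smul, ← Complex.coe_smul, Matrix.smul_mul,
    Matrix.mul_smul, (isLinearMap_twirl integrable_logisticDensity (isHermitian_half_smul (hL s))
    (isHermitian_half_smul (hL s₀))).map_smul, ← sub_eq_twirl_exp_sub_exp (hL s) (hL s₀)]
end QCBM

/-! ### Joint eigenbasis and block-diagonal Hamiltonians -/

namespace QCBM
open Filter Topology NormedSpace

section JointEigenbasis

variable {κ : Type*} [Fintype κ] [DecidableEq κ]

lemma star_dotProduct_orthonormalBasis (e : OrthonormalBasis κ ℂ (EuclideanSpace ℂ κ)) (x y : κ) :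
    star (e x).ofLp ⬝ᵥ (e y).ofLp = if x = y then 1 else 0 := by
  rw [← orthonormal_iff_ite.1 e.orthonormal x y, EuclideanSpace.inner_eq_star_dotProduct,
    dotProduct_comm]

/-- The unitary matrix whose columns are the vectors of an orthonormal basis. -/
noncomputable def basisMatrix (e : OrthonormalBasis κ ℂ (EuclideanSpace ℂ κ)) : Matrix κ κ ℂ :=
  Matrix.of fun k x => (e x).ofLp k

lemma conjTranspose_basisMatrix_mul_self (e : OrthonormalBasis κ ℂ (EuclideanSpace ℂ κ)) :
    (basisMatrix e)ᴴ * basisMatrix e = 1 := by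
  ext x y
  rw [Matrix.one_apply, ← star_dotProduct_orthonormalBasis e]
  rfl

lemma basisMatrix_mul_conjTranspose_self (e : OrthonormalBasis κ ℂ (EuclideanSpace ℂ κ)) :
    basisMatrix e * (basisMatrix e)ᴴ = 1 :=
  mul_eq_one_comm.1 (conjTranspose_basisMatrix_mul_self e)

lemma sum_ketbra (e : OrthonormalBasis κ ℂ (EuclideanSpace ℂ κ)) : ∑ x, ketbra (e x) = 1 := by
  rw [← basisMatrix_mul_conjTranspose_self e]
  ext k l
  rw [Matrix.sum_apply]
  rfl

lemma trace_ketbra (e : OrthonormalBasis κ ℂ (EuclideanSpace ℂ κ)) (x : κ) :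
    (ketbra (e x)).trace = 1 := by
  rw [ketbra, Matrix.trace_vecMulVec, dotProduct_comm, star_dotProduct_orthonormalBasis, if_pos rfl]

lemma mul_ketbra_of_mulVec {κ : Type*} [Fintype κ] {M : Matrix κ κ ℂ} {ψ : EuclideanSpace ℂ κ} {c : ℂ}
    (h : M *ᵥ ψ.ofLp = c • ψ.ofLp) : M * ketbra ψ = c • ketbra ψ := by
  rw [ketbra, Matrix.mul_vecMulVec, h, Matrix.smul_vecMulVec]

/-- The joint eigenspaces of commuting symmetric operators are mutually orthogonal and span, so
orthonormal bases of them glue to one of the whole space. -/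
lemma exists_orthonormalBasis_of_commuting_symmetric {κ : Type*} [Fintype κ] {E : Type*} [NormedAddCommGroup E]
    [InnerProductSpace ℂ E] [FiniteDimensional ℂ E] (hcard : Module.finrank ℂ E = Fintype.card κ)
    {n : ℕ} {T : Fin n → E →ₗ[ℂ] E} (hT : ∀ j, (T j).IsSymmetric)
    (hTc : ∀ j k, Commute (T j) (T k)) :
    ∃ (e : OrthonormalBasis κ ℂ E) (h : Fin n → κ → ℝ), ∀ j x, T j (e x) = (h j x : ℂ) • e x := by
  set F : (Fin n → ℂ) → Submodule ℂ E := fun χ => ⨅ j, Module.End.eigenspace (T j) (χ j)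
  have hFtop : ⨆ χ, F χ = ⊤ :=
    LinearMap.IsSymmetric.iSup_iInf_eq_top_of_commute hT fun j k _ => hTc j k
  set v : (Σ χ, Fin (Module.finrank ℂ (F χ))) → E := fun a =>
    (stdOrthonormalBasis ℂ (F a.1) a.2 : E) with hv_def
  have hv : Orthonormal ℂ v :=
    (LinearMap.IsSymmetric.orthogonalFamily_iInf_eigenspaces hT).orthonormal_sigma_orthonormal
      fun χ => (stdOrthonormalBasis ℂ (F χ)).orthonormal
  have hspan : ⊤ ≤ Submodule.span ℂ (Set.range v) := by
    rw [← hFtop]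
    refine iSup_le fun χ => ?_
    have h1 := (stdOrthonormalBasis ℂ (F χ)).toBasis.span_eq
    have h2 : F χ = (⊤ : Submodule ℂ (F χ)).map (F χ).subtype := by simp
    rw [h2, ← h1, Submodule.map_span]
    refine Submodule.span_mono ?_
    rintro _ ⟨_, ⟨i, rfl⟩, rfl⟩
    exact ⟨⟨χ, i⟩, by simp [hv_def]⟩
  -- The index ranges over all tuples `χ` of complex numbers; linear independence of `v` in finite
  -- dimension leaves only finitely many indices.
  have hfin : Finite (Σ χ, Fin (Module.finrank ℂ (F χ))) := hv.linearIndependent.finite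
  have := Fintype.ofFinite (Σ χ, Fin (Module.finrank ℂ (F χ)))
  set e₀ := OrthonormalBasis.mk hv hspan with he₀
  set r := Fintype.equivOfCardEq
    ((Module.finrank_eq_card_basis e₀.toBasis).symm.trans hcard)
  have hmem : ∀ x, e₀.reindex r x ∈ F (r.symm x).1 := fun x => by
    rw [OrthonormalBasis.reindex_apply, he₀, OrthonormalBasis.coe_mk]
    exact Subtype.coe_prop _
  have hev : ∀ j x, T j (e₀.reindex r x) = (r.symm x).1 j • e₀.reindex r x := fun j x =>
    Module.End.mem_eigenspace_iff.1 ((Submodule.mem_iInf _).1 (hmem x) j)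
  refine ⟨e₀.reindex r, fun j x => ((r.symm x).1 j).re, fun j x => ?_⟩
  have hreal : (((r.symm x).1 j).re : ℂ) = (r.symm x).1 j :=
    Complex.conj_eq_iff_re.1 ((hT j).conj_eigenvalue_eq_self
      (Module.End.hasEigenvalue_of_hasEigenvector
        ⟨Module.End.mem_eigenspace_iff.2 (hev j x), (e₀.reindex r).orthonormal.ne_zero x⟩))
  rw [hreal]
  exact hev j x

lemma exists_orthonormalBasis_joint_eigenvectors {n : ℕ} (H : Fin n → Matrix κ κ ℂ)
    (hH : ∀ j, (H j).IsHermitian) (hcomm : ∀ j k, Commute (H j) (H k)) :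
    ∃ (e : OrthonormalBasis κ ℂ (EuclideanSpace ℂ κ)) (h : Fin n → κ → ℝ),
      ∀ j, H j = ∑ x, (h j x : ℂ) • ketbra (e x) := by
  have hT : ∀ j, (Matrix.toEuclideanLin (H j)).IsSymmetric := fun j =>
    Matrix.isSymmetric_toEuclideanLin_iff.2 (hH j)
  have hTc : ∀ j k, Commute (S := Module.End ℂ (EuclideanSpace ℂ κ))
      (Matrix.toEuclideanLin (H j)) (Matrix.toEuclideanLin (H k)) := by
    intro j k
    refine LinearMap.ext fun v => ?_
    rw [Module.End.mul_apply, Module.End.mul_apply, Matrix.toLpLin_apply, Matrix.toLpLin_apply,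
      Matrix.toLpLin_apply, Matrix.toLpLin_apply, Matrix.mulVec_mulVec, Matrix.mulVec_mulVec,
      (hcomm j k).eq]
  obtain ⟨e, h, he⟩ := exists_orthonormalBasis_of_commuting_symmetric (κ := κ)
    finrank_euclideanSpace hT hTc
  refine ⟨e, h, fun j => ?_⟩
  rw [← mul_one (H j), ← sum_ketbra e, Finset.mul_sum]
  exact Finset.sum_congr rfl fun x _ => mul_ketbra_of_mulVec (congrArg WithLp.ofLp (he j x))

end JointEigenbasis

section Kronecker

variable {ι κ : Type*} [Fintype ι] [DecidableEq ι] [Fintype κ] [DecidableEq κ]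

/-- Exhibits the sum as a unitary conjugate of a block-diagonal matrix, so that `exp` acts block by
block. -/
lemma sum_kronecker_ketbra (e : OrthonormalBasis κ ℂ (EuclideanSpace ℂ κ))
    (A : κ → Matrix ι ι ℂ) : ∑ x, A x ⊗ₖ ketbra (e x) =
      ((1 : Matrix ι ι ℂ) ⊗ₖ basisMatrix e) * Matrix.blockDiagonal A *
        ((1 : Matrix ι ι ℂ) ⊗ₖ (basisMatrix e)ᴴ) := by
  ext ⟨i, k⟩ ⟨j, l⟩
  simp only [Matrix.sum_apply, Matrix.kroneckerMap_apply, Matrix.mul_apply, Fintype.sum_prod_type,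
    Matrix.one_apply, Matrix.blockDiagonal_apply, ite_mul, mul_ite, one_mul, zero_mul, mul_zero,
    Finset.sum_ite_eq, Finset.sum_ite_eq', Finset.mem_univ, if_true,
    Finset.sum_ite_irrel, Finset.sum_const_zero]
  refine Finset.sum_congr rfl fun x _ => ?_
  simp only [ketbra, basisMatrix, Matrix.vecMulVec_apply, Matrix.conjTranspose_apply,
    Matrix.of_apply, Pi.star_apply]
  ring

lemma exp_sum_kronecker_ketbra (e : OrthonormalBasis κ ℂ (EuclideanSpace ℂ κ))
    (A : κ → Matrix ι ι ℂ) :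
    exp (∑ x, A x ⊗ₖ ketbra (e x)) = ∑ x, exp (A x) ⊗ₖ ketbra (e x) := by
  have h1 : ((1 : Matrix ι ι ℂ) ⊗ₖ basisMatrix e) * ((1 : Matrix ι ι ℂ) ⊗ₖ (basisMatrix e)ᴴ) = 1 := by
    rw [← Matrix.mul_kronecker_mul, basisMatrix_mul_conjTranspose_self, one_mul,
      Matrix.one_kronecker_one]
  have h := Matrix.exp_units_conj ⟨_, _, h1, mul_eq_one_comm.1 h1⟩ (Matrix.blockDiagonal A)
  simp only [Units.inv_mk] at h
  have h2 : exp A = fun x => exp (A x) := by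
    open scoped Matrix.Norms.L2Operator in
    let : NormedAlgebra ℚ (Matrix ι ι ℂ) := NormedAlgebra.restrictScalars ℚ ℂ _
    exact funext (Pi.coe_exp A)
  rw [Matrix.exp_blockDiagonal, h2] at h
  rw [sum_kronecker_ketbra, sum_kronecker_ketbra]
  exact h

lemma partialTrace_sum_kronecker_ketbra {ι κ : Type*} [Fintype κ] [DecidableEq κ] (e : OrthonormalBasis κ ℂ (EuclideanSpace ℂ κ))
    (A : κ → Matrix ι ι ℂ) : partialTrace (∑ x, A x ⊗ₖ ketbra (e x)) = ∑ x, A x := by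
  ext i j
  simp only [partialTrace, Matrix.of_apply, Matrix.sum_apply, Matrix.kroneckerMap_apply]
  rw [Finset.sum_comm]
  refine Finset.sum_congr rfl fun x _ => ?_
  rw [← Finset.mul_sum]
  exact (congrArg _ (trace_ketbra e x)).trans (mul_one _)

lemma trace_sum_kronecker_ketbra {ι κ : Type*} [Fintype ι] [Fintype κ] [DecidableEq κ] (e : OrthonormalBasis κ ℂ (EuclideanSpace ℂ κ))
    (A : κ → Matrix ι ι ℂ) : (∑ x, A x ⊗ₖ ketbra (e x)).trace = ∑ x, (A x).trace := by
  simp only [Matrix.trace_sum, Matrix.trace_kronecker, trace_ketbra, mul_one]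

lemma hamiltonian_eq_sum {ι κ : Type*} [DecidableEq ι] [Fintype κ] [DecidableEq κ] {m n : ℕ}
    {V : Fin m → Matrix ι ι ℂ} {H : Fin n → Matrix κ κ ℂ}
    {e : OrthonormalBasis κ ℂ (EuclideanSpace ℂ κ)} {h : Fin n → κ → ℝ} (hH : ∀ j, H j = ∑ x, (h j x : ℂ) • ketbra (e x))
    (a : Fin m → ℝ) (b : Fin n → ℝ) (w : Fin m → Fin n → ℝ) :
    hamiltonian V H a b w = ∑ x, condHamiltonian V h a b w x ⊗ₖ ketbra (e x) := by
  ext ⟨i, k⟩ ⟨j, l⟩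
  rw [hamiltonian, ← sum_ketbra e]
  simp only [hH, condHamiltonian, Matrix.sum_apply, Matrix.add_apply, Matrix.smul_apply,
    Matrix.kroneckerMap_apply, smul_eq_mul]
  push_cast
  simp only [add_mul, Finset.sum_mul, Finset.mul_sum, Finset.sum_add_distrib]
  rw [add_left_comm, ← add_assoc]
  refine congrArg₂ _ (congrArg₂ _ ?_ ?_) ?_
  · rw [Finset.sum_comm]
    simp only [mul_assoc]
  · rw [Finset.sum_comm]
    refine Finset.sum_congr rfl fun x _ => Finset.sum_congr rfl fun j' _ => ?_
    ring
  · rw [Finset.sum_congr rfl fun i' _ => Finset.sum_comm]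
    rw [Finset.sum_comm]
    refine Finset.sum_congr rfl fun x _ => Finset.sum_congr rfl fun i' _ =>
      Finset.sum_congr rfl fun j' _ => ?_
    ring

end Kronecker
end QCBM

/-! ### Thermal states, matrix powers, and the derivative of the logarithm -/

namespace QCBM
open Filter Topology NormedSpace

section Thermal

variable {ι : Type*} [Fintype ι] [DecidableEq ι]

lemma posDef_exp {A : Matrix ι ι ℂ} (hA : A.IsHermitian) : (exp A).PosDef := by
  open scoped MatrixOrder Matrix.Norms.L2Operator in
  rw [← Matrix.isStrictlyPositive_iff_posDef]
  exact (Matrix.isUnit_exp A).isStrictlyPositive (IsSelfAdjoint.exp_nonneg hA)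

lemma exp_matLog {A : Matrix ι ι ℂ} (hA : A.PosDef) : exp (matLog A) = A := by
  open scoped MatrixOrder Matrix.Norms.L2Operator in
  exact CFC.exp_log A hA.isStrictlyPositive

lemma isHermitian_matLog (A : Matrix ι ι ℂ) : (matLog A).IsHermitian :=
  (cfc_predicate Real.log A : IsSelfAdjoint _)

lemma continuousAt_matLog {σ : ℝ → Matrix ι ι ℂ} {s₀ : ℝ} (hσ : ∀ s, (σ s).PosDef)
    (hc : ContinuousAt σ s₀) : ContinuousAt (fun s => matLog (σ s)) s₀ := by
  open scoped MatrixOrder Matrix.Norms.L2Operator in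
  have h := (CFC.continuousOn_log (A := Matrix ι ι ℂ)).continuousWithinAt (x := σ s₀)
    ⟨(hσ s₀).isHermitian, (hσ s₀).isUnit⟩
  exact h.tendsto.comp (tendsto_nhdsWithin_of_tendsto_nhds_of_eventually_within _ hc.tendsto
    (.of_forall fun s => ⟨(hσ s).isHermitian, (hσ s).isUnit⟩))

/-- All factors are exponentials of multiples of `ln σ`, with exponents adding to `-½ + 1 - ½ = 0`.
-/
lemma matPow_mul_self_mul_matPow {σ : Matrix ι ι ℂ} (hσ : σ.PosDef) :
    matPow σ (-1 / 2) * σ * matPow σ (-1 / 2) = 1 := by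
  conv_lhs => enter [1, 2]; rw [← exp_matLog hσ]
  have hc : ∀ z z' : ℂ, Commute (z • matLog σ) (z' • matLog σ) := fun z z' =>
    ((Commute.refl _).smul_left z).smul_right z'
  have h1 := hc (-1 / 2) 1
  have h2 := hc (-1 / 2 + 1) (-1 / 2)
  rw [one_smul] at h1
  rw [matPow, ← Matrix.exp_add_of_commute _ _ h1, ← one_smul ℂ (matLog σ), smul_smul, mul_one,
    ← add_smul, ← Matrix.exp_add_of_commute _ _ h2, ← add_smul]
  norm_num

lemma isHermitian_matPow_neg_half (σ : Matrix ι ι ℂ) : (matPow σ (-1 / 2)).IsHermitian := by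
  refine Matrix.IsHermitian.exp ?_
  rw [Matrix.IsHermitian, Matrix.conjTranspose_smul, isHermitian_matLog]
  congr 1
  simp

lemma trace_exp_ne_zero [Nonempty ι] {A : Matrix ι ι ℂ} (hA : A.IsHermitian) :
    (exp A).trace ≠ 0 := (posDef_exp hA).trace_pos.ne'

lemma twirl_of_commute {f : ℝ → ℝ} {A X : Matrix ι ι ℂ} (h : Commute A X) :
    twirl f A A X = ((∫ t, f t : ℝ) : ℂ) • X := by
  have h1 : ∀ z : ℂ, Commute (exp (z • A)) X := fun z => by
    open scoped Matrix.Norms.L2Operator in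
    let : NormedAlgebra ℚ (Matrix ι ι ℂ) := NormedAlgebra.restrictScalars ℚ ℂ _
    exact (h.smul_left z).exp_left
  have h2 : ∀ z : ℂ, exp ((-z) • A) * X * exp (z • A) = X := fun z => by
    rw [(h1 _).eq, mul_assoc, neg_smul, exp_neg_mul_exp, mul_one]
  ext i j
  simp only [twirl, h2, Matrix.of_apply, Matrix.smul_apply, smul_eq_mul]
  rw [MeasureTheory.integral_mul_const, integral_complex_ofReal]

lemma commute_exp_neg (A : Matrix ι ι ℂ) : Commute A (exp (-A)) := by
  open scoped Matrix.Norms.L2Operator in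
  let : NormedAlgebra ℚ (Matrix ι ι ℂ) := NormedAlgebra.restrictScalars ℚ ℂ _
  exact (Commute.refl A).neg_right.exp_right

lemma Phi_exp_neg (A : Matrix ι ι ℂ) : Phi A (exp (-A)) = exp (-A) := by
  rw [Phi_eq_twirl, twirl_of_commute (commute_exp_neg A), integral_tentDensity]
  simp

lemma trace_mul_Phi {A : Matrix ι ι ℂ} (hA : A.IsHermitian) (R X : Matrix ι ι ℂ) :
    (R * Phi A X).trace = (Phi A R * X).trace :=
  trace_mul_twirl integrable_tentDensity hA tentDensity_neg R X

lemma trace_mul_Upsilon (σ R X : Matrix ι ι ℂ) :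
    (R * Upsilon σ X).trace = (Upsilon σ R * X).trace := by
  rw [Upsilon_eq_twirl, Upsilon_eq_twirl]
  exact trace_mul_twirl integrable_logisticDensity (isHermitian_half_smul (isHermitian_matLog σ))
    logisticDensity_neg R X

lemma isChannel_Phi {A : Matrix ι ι ℂ} (hA : A.IsHermitian) : IsChannel (Phi A) :=
  isChannel_twirl integrable_tentDensity tentDensity_nonneg tentDensity_neg integral_tentDensity hA

lemma isChannel_Upsilon (σ : Matrix ι ι ℂ) : IsChannel (Upsilon σ) := by
  rw [funext (Upsilon_eq_twirl σ)]
  exact isChannel_twirl integrable_logisticDensity logisticDensity_nonneg logisticDensity_neg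
    integral_logisticDensity (isHermitian_half_smul (isHermitian_matLog σ))

lemma posSemidef_Upsilon (σ : Matrix ι ι ℂ) {X : Matrix ι ι ℂ} (hX : X.PosSemidef) :
    (Upsilon σ X).PosSemidef := by
  rw [Upsilon_eq_twirl]
  exact posSemidef_twirl integrable_logisticDensity logisticDensity_nonneg
    (isHermitian_half_smul (isHermitian_matLog σ)) hX

lemma Upsilon_one (σ : Matrix ι ι ℂ) : Upsilon σ 1 = 1 := by
  rw [Upsilon_eq_twirl, twirl_one, integral_logisticDensity]
  simp

lemma Xi_smul (c : ℂ) (τ σ R : Matrix ι ι ℂ) : Xi (c • τ) σ R = c • Xi τ σ R := by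
  simp only [Xi, Matrix.smul_mul, Matrix.mul_smul, ← smul_add]
  rw [smul_comm]

/-- Under the trace the anticommutator collapses by cyclicity. This links `Tr[Σˣ(ρ)]` to the
measurement operators `Λₓ`. -/
lemma trace_Xi (τ σ R : Matrix ι ι ℂ) : (Xi τ σ R).trace =
    (matPow σ (-1 / 2) * τ * matPow σ (-1 / 2) * R).trace := by
  rw [Xi, Matrix.trace_smul, Matrix.trace_add, Matrix.trace_mul_comm _ τ, smul_eq_mul,
    ← two_mul, ← mul_assoc, one_div, inv_mul_cancel₀ two_ne_zero, one_mul,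
    ← mul_assoc, ← mul_assoc, Matrix.trace_mul_comm]
  simp only [mul_assoc]

/-- The derivative of `s ↦ Tr[ρ ln σ(s)]` along a curve of positive definite matrices. -/
lemma hasDerivAt_trace_mul_matLog (ρ : Matrix ι ι ℂ) {σ : ℝ → Matrix ι ι ℂ} {D : Matrix ι ι ℂ}
    {s₀ : ℝ} (hσ : ∀ s, (σ s).PosDef)
    (h : open scoped Matrix.Norms.L2Operator in HasDerivAt σ D s₀) :
    HasDerivAt (fun s => (ρ * matLog (σ s)).trace)
      (matPow (σ s₀) (-1 / 2) * Upsilon (σ s₀) ρ * matPow (σ s₀) (-1 / 2) * D).trace s₀ := by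
  open scoped Matrix.Norms.L2Operator in
  have h1 := hasDerivAt_of_hasDerivAt_exp (fun s => isHermitian_matLog (σ s))
    (continuousAt_matLog hσ h.continuousAt) (D := D) (by simpa only [exp_matLog (hσ _)] using h)
  have h2 := ((Matrix.traceLinearMap ι ℂ ℂ ∘ₗ
    LinearMap.mulLeft ℂ ρ).toContinuousLinearMap.restrictScalars ℝ).hasFDerivAt.comp_hasDerivAt
      s₀ h1
  refine h2.congr_deriv ?_
  change (ρ * _).trace = _
  -- Self-adjointness moves `Υ` from the perturbation `D` onto `ρ`; cyclicity then gathers both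
  -- `σ^{-1/2}` around it.
  rw [← Upsilon_eq_twirl, trace_mul_Upsilon, ← matPow, ← mul_assoc, ← mul_assoc,
    Matrix.trace_mul_comm]
  simp only [mul_assoc]

end Thermal
end QCBM

/-! ### Gradient for a mixture of thermal states -/

namespace QCBM
open Filter Topology NormedSpace

section Mixture

variable {ι κ : Type*} [Fintype ι] [DecidableEq ι] [Fintype κ]

/-- The partition function `∑ₓ Tr[e^{-Gˣ}]`. -/
noncomputable def partitionFunction (G : κ → Matrix ι ι ℂ) : ℂ := ∑ x, (exp (-G x)).trace

/-- The mixture `∑ₓ e^{-Gˣ} / ∑ₓ Tr[e^{-Gˣ}]` of thermal states. -/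
noncomputable def thermalMixture (G : κ → Matrix ι ι ℂ) : Matrix ι ι ℂ :=
  (partitionFunction G)⁻¹ • ∑ x, exp (-G x)

/-- The weight `Tr[e^{-Gˣ}] / ∑ᵧ Tr[e^{-Gʸ}]` of a thermal state in the mixture. -/
noncomputable def thermalWeight (G : κ → Matrix ι ι ℂ) (x : κ) : ℂ :=
  (exp (-G x)).trace / partitionFunction G

/-- Lets the weight be absorbed into the state, so that `pₓ σˣ` can be traded for `Z⁻¹ e^{-Gˣ}`. -/
lemma mul_expval_Phi_Xi (c : ℂ) {A : Matrix ι ι ℂ} (hA : A.IsHermitian) (K τ σ R : Matrix ι ι ℂ) :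
    c * expval K (Phi A (Xi τ σ R)) = expval K (Phi A (Xi (c • τ) σ R)) := by
  rw [Xi_smul, (isChannel_Phi hA).1.map_smul, expval, expval, Matrix.mul_smul, Matrix.trace_smul,
    smul_eq_mul]

lemma mul_expval {ι : Type*} [Fintype ι] (c : ℂ) (K τ : Matrix ι ι ℂ) : c * expval K τ = expval K (c • τ) := by
  rw [expval, expval, Matrix.mul_smul, Matrix.trace_smul, smul_eq_mul]

/-- The derivative of the unnormalized weight `Tr[Q e^{-G(s)}]`, against a fixed operator `Q`. -/
lemma trace_mul_deriv_exp_neg {A : Matrix ι ι ℂ} (hA : A.IsHermitian) (Q K : Matrix ι ι ℂ) :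
    (Q * ((-1 / 2 : ℂ) • (exp (-A) * Phi A K + Phi A K * exp (-A)))).trace =
      -expval K (Phi A ((1 / 2 : ℂ) • (exp (-A) * Q + Q * exp (-A)))) := by
  rw [expval, Matrix.trace_mul_comm K, ← trace_mul_Phi hA, Matrix.mul_smul, Matrix.smul_mul,
    Matrix.trace_smul, Matrix.trace_smul, mul_add, add_mul, Matrix.trace_add, Matrix.trace_add,
    ← mul_assoc, ← mul_assoc, Matrix.trace_mul_comm _ (exp (-A)), ← mul_assoc, smul_eq_mul,
    smul_eq_mul]
  ring

lemma trace_exp_neg_pos {ι κ : Type*} [Fintype ι] [DecidableEq ι] [Nonempty ι]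
    {G : κ → Matrix ι ι ℂ} (hG : ∀ x, (G x).IsHermitian) (x : κ) : 0 < (exp (-G x)).trace :=
  (posDef_exp (hG x).neg).trace_pos

variable [Nonempty ι] [Nonempty κ] {G : κ → Matrix ι ι ℂ}

lemma partitionFunction_pos (hG : ∀ x, (G x).IsHermitian) : 0 < partitionFunction G :=
  Finset.sum_pos (fun x _ => trace_exp_neg_pos hG x) Finset.univ_nonempty

lemma posDef_thermalMixture (hG : ∀ x, (G x).IsHermitian) : (thermalMixture G).PosDef := by
  have h : (∑ x, exp (-G x)).PosDef :=
    Matrix.posDef_sum Finset.univ_nonempty fun x _ => posDef_exp (hG x).neg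
  exact h.smul (inv_pos.2 (partitionFunction_pos hG))

lemma thermalWeight_smul_thermal {ι κ : Type*} [Fintype ι] [DecidableEq ι]
    [Fintype κ] [Nonempty ι] {G : κ → Matrix ι ι ℂ} (hG : ∀ x, (G x).IsHermitian) (x : κ) :
    thermalWeight G x • thermal (G x) = (partitionFunction G)⁻¹ • exp (-G x) := by
  rw [thermalWeight, thermal, smul_smul]
  congr 1
  have := (trace_exp_neg_pos hG x).ne'
  field_simp

lemma sum_thermalWeight_smul_thermal {ι κ : Type*} [Fintype ι] [DecidableEq ι]
    [Fintype κ] [Nonempty ι] {G : κ → Matrix ι ι ℂ} (hG : ∀ x, (G x).IsHermitian) :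
    ∑ x, thermalWeight G x • thermal (G x) = thermalMixture G := by
  simp only [thermalWeight_smul_thermal hG, thermalMixture, Finset.smul_sum]

lemma trace_thermal {A : Matrix ι ι ℂ} (hA : A.IsHermitian) : (thermal A).trace = 1 := by
  rw [thermal, Matrix.trace_smul, smul_eq_mul, inv_mul_cancel₀ (trace_exp_ne_zero hA.neg)]

/-- The gradient of the relative entropy to a mixture of thermal states. -/
lemma hasDerivAt_relEntropy_thermalMixture {ρ : Matrix ι ι ℂ} (hρ : IsState ρ)
    {G : ℝ → κ → Matrix ι ι ℂ} {K : κ → Matrix ι ι ℂ} {s₀ : ℝ} (hG : ∀ s x, (G s x).IsHermitian)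
    (h : ∀ x, open scoped Matrix.Norms.L2Operator in HasDerivAt (fun s => G s x) (K x) s₀) :
    HasDerivAt (fun s => ((relEntropy ρ (thermalMixture (G s)) : ℝ) : ℂ))
      (∑ x, thermalWeight (G s₀) x * expval (K x) (Phi (G s₀ x) (Xi (thermal (G s₀ x))
          (thermalMixture (G s₀)) (Upsilon (thermalMixture (G s₀)) ρ))) -
        ∑ x, thermalWeight (G s₀) x * expval (K x) (thermal (G s₀ x))) s₀ := by
  open scoped Matrix.Norms.L2Operator in
  set σ := fun s => thermalMixture (G s) with hσdef
  set Z := partitionFunction (G s₀) with hZdef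
  set E := fun x => exp (-G s₀ x) with hEdef
  set D := fun x => (-1 / 2 : ℂ) • (E x * Phi (G s₀ x) (K x) + Phi (G s₀ x) (K x) * E x) with hDdef
  have hσ : ∀ s, (σ s).PosDef := fun s => posDef_thermalMixture (hG s)
  have hZ0 : Z ≠ 0 := (partitionFunction_pos (hG s₀)).ne'
  have hE : ∀ x, HasDerivAt (fun s => exp (-G s x)) (D x) s₀ := fun x =>
    hasDerivAt_exp_neg (fun s => hG s x) (h x)
  have hS : HasDerivAt (fun s => ∑ x, exp (-G s x)) (∑ x, D x) s₀ :=
    HasDerivAt.fun_sum fun x _ => hE x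
  have hZ : HasDerivAt (fun s => partitionFunction (G s)) (∑ x, D x).trace s₀ := by
    have := ((Matrix.traceLinearMap ι ℂ ℂ).toContinuousLinearMap.restrictScalars
      ℝ).hasFDerivAt.comp_hasDerivAt s₀ hS
    refine (this.congr_of_eventuallyEq (.of_forall fun s => ?_))
    exact (Matrix.trace_sum _ _).symm
  -- Quotient rule for `Z⁻¹ ∑ₓ e^{-Gˣ}`.
  have hσ' : HasDerivAt σ (Z⁻¹ • (∑ x, D x) + (-(∑ x, D x).trace / Z ^ 2) • ∑ x, E x) s₀ :=
    (hZ.fun_inv hZ0).smul hS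
  set Q := matPow (σ s₀) (-1 / 2) * Upsilon (σ s₀) ρ * matPow (σ s₀) (-1 / 2) with hQdef
  -- `Tr[Q σ] = Tr[Υ(ρ)] = Tr ρ = 1`, so the derivative of the normalization contributes a term free
  -- of `ρ`.
  have hQσ : (Q * ∑ x, E x).trace = Z := by
    have h1 : ∑ x, E x = Z • σ s₀ := by
      simp only [hσdef, thermalMixture, ← hZdef, smul_smul, mul_inv_cancel₀ hZ0, one_smul, hEdef]
    have h2 : (Q * σ s₀).trace = 1 := by
      rw [hQdef, mul_assoc, mul_assoc, Matrix.trace_mul_comm, mul_assoc, matPow_mul_self_mul_matPow (hσ s₀), mul_one, (isChannel_Upsilon _).2.2, hρ.2]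
    rw [h1, Matrix.mul_smul, Matrix.trace_smul, h2, smul_eq_mul, mul_one]
  have hlog := hasDerivAt_trace_mul_matLog ρ hσ hσ'
  have hD := hlog.const_sub (ρ * matLog ρ).trace
  have hfun : (fun s => ((relEntropy ρ (σ s) : ℝ) : ℂ)) =
      fun s => (ρ * matLog ρ).trace - (ρ * matLog (σ s)).trace :=
    funext fun s => relEntropy_coe hρ.1.isHermitian _
  rw [hfun]
  refine hD.congr_deriv ?_
  rw [← hQdef]
  have e1 : (Q * ∑ x, D x).trace = -∑ x, expval (K x) (Phi (G s₀ x)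
      (Xi (E x) (σ s₀) (Upsilon (σ s₀) ρ))) := by
    rw [Finset.mul_sum, Matrix.trace_sum, ← Finset.sum_neg_distrib]
    exact Finset.sum_congr rfl fun x _ => trace_mul_deriv_exp_neg (hG s₀ x) Q (K x)
  -- The case `Q = 1` of the trace formula, where `Φ` disappears because it fixes `e^{-Gˣ}`.
  have e2 : (∑ x, D x).trace = -∑ x, expval (K x) (E x) := by
    rw [Matrix.trace_sum, ← Finset.sum_neg_distrib]
    refine Finset.sum_congr rfl fun x _ => ?_
    have := trace_mul_deriv_exp_neg (hG s₀ x) 1 (K x)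
    have h2 : (1 / 2 : ℂ) • (E x + E x) = E x := by
      rw [← two_smul ℂ, smul_smul]
      norm_num
    rw [one_mul, mul_one, one_mul, h2, hEdef, Phi_exp_neg] at this
    exact this
  have e3 : ∀ x, thermalWeight (G s₀) x * expval (K x) (Phi (G s₀ x) (Xi (thermal (G s₀ x))
      (σ s₀) (Upsilon (σ s₀) ρ))) =
      Z⁻¹ * expval (K x) (Phi (G s₀ x) (Xi (E x) (σ s₀) (Upsilon (σ s₀) ρ))) := fun x => by
    rw [mul_expval_Phi_Xi _ (hG s₀ x), thermalWeight_smul_thermal (hG s₀),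
      mul_expval_Phi_Xi _ (hG s₀ x)]
  have e4 : ∀ x, thermalWeight (G s₀) x * expval (K x) (thermal (G s₀ x)) =
      Z⁻¹ * expval (K x) (E x) := fun x => by
    rw [mul_expval, thermalWeight_smul_thermal (hG s₀), mul_expval]
  change _ = (∑ x, thermalWeight (G s₀) x * expval (K x) (Phi (G s₀ x) (Xi (thermal (G s₀ x))
      (σ s₀) (Upsilon (σ s₀) ρ)))) - _
  simp only [e3, e4, ← Finset.mul_sum]
  rw [mul_add, Matrix.trace_add, Matrix.mul_smul, Matrix.mul_smul, Matrix.trace_smul,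
    Matrix.trace_smul, hQσ, e1, e2, smul_eq_mul, smul_eq_mul]
  field_simp
  ring

end Mixture
end QCBM

/-! ### The restricted machine as a mixture -/

namespace QCBM
open Filter Topology NormedSpace

section Machine

variable {ι κ : Type*} [DecidableEq ι] {m n : ℕ} (V : Fin m → Matrix ι ι ℂ) (h : Fin n → κ → ℝ)
  (a : Fin m → ℝ) (b : Fin n → ℝ) (w : Fin m → Fin n → ℝ) (x : κ)

lemma condHamiltonian_eq_add : condHamiltonian V h a b w x =
    ((∑ j, b j * h j x : ℝ) : ℂ) • 1 + condHamiltonianTilde V h a w x := rfl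

/-- Varying one parameter moves every conditional Hamiltonian along a straight line; its direction
is the perturbation `K x` entering the gradient formula. -/
lemma condHamiltonian_update_left (i : Fin m) (s : ℝ) :
    condHamiltonian V h (Function.update a i s) b w x =
      condHamiltonian V h a b w x + ((s - a i : ℝ) : ℂ) • V i := by
  have h1 : ∀ k, Function.update a i s k = a k + if k = i then s - a i else 0 := by
    intro k
    rcases eq_or_ne k i with rfl | hk <;> simp [*]
  simp only [condHamiltonian, h1, add_assoc, add_right_inj]
  simp only [Complex.ofReal_add, add_smul, Finset.sum_add_distrib, apply_ite Complex.ofReal,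
    Complex.ofReal_zero, ite_smul, zero_smul, Finset.sum_ite_eq', Finset.mem_univ, if_true]
  abel

lemma condHamiltonian_update_mid (j : Fin n) (s : ℝ) :
    condHamiltonian V h a (Function.update b j s) w x =
      condHamiltonian V h a b w x + ((s - b j : ℝ) : ℂ) • ((h j x : ℂ) • (1 : Matrix ι ι ℂ)) := by
  have h1 : ∀ k, Function.update b j s k = b k + if k = j then s - b j else 0 := by
    intro k
    rcases eq_or_ne k j with rfl | hk <;> simp [*]
  simp only [condHamiltonian, h1, add_mul, Finset.sum_add_distrib, ite_mul, zero_mul,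
    Finset.sum_ite_eq', Finset.mem_univ, if_true, Complex.ofReal_add, add_smul, smul_smul,
    Complex.ofReal_mul]
  abel

lemma condHamiltonian_update_right (i : Fin m) (j : Fin n) (s : ℝ) :
    condHamiltonian V h a b (Function.update w i (Function.update (w i) j s)) x =
      condHamiltonian V h a b w x + ((s - w i j : ℝ) : ℂ) • ((h j x : ℂ) • V i) := by
  have h1 : ∀ k l, Function.update w i (Function.update (w i) j s) k l =
      w k l + if k = i then (if l = j then s - w i j else 0) else 0 := by
    intro k l
    rcases eq_or_ne k i with rfl | hk
    · rcases eq_or_ne l j with rfl | hl <;> simp [*]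
    · simp [hk]
  have h2 : ∀ k, ∑ l, Function.update w i (Function.update (w i) j s) k l * h l x =
      ∑ l, w k l * h l x + if k = i then (s - w i j) * h j x else 0 := by
    intro k
    simp only [h1, add_mul, Finset.sum_add_distrib, ite_mul, zero_mul]
    rcases eq_or_ne k i with rfl | hk <;> simp [*]
  simp only [condHamiltonian, h2, ← add_assoc]
  simp only [add_assoc, add_right_inj]
  simp only [← add_assoc, Complex.ofReal_add _ (ite _ _ _), add_smul, Finset.sum_add_distrib,
    apply_ite Complex.ofReal,
    Complex.ofReal_zero, ite_smul, zero_smul, Finset.sum_ite_eq', Finset.mem_univ, if_true,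
    smul_smul, Complex.ofReal_mul]

variable {V}

lemma isHermitian_real_smul {ι : Type*} {A : Matrix ι ι ℂ} (hA : A.IsHermitian) (c : ℝ) :
    ((c : ℂ) • A).IsHermitian := by
  rw [Matrix.IsHermitian, Matrix.conjTranspose_smul, hA.eq, Complex.star_def, Complex.conj_ofReal]

lemma isHermitian_condHamiltonianTilde {ι κ : Type*} {m n : ℕ} {V : Fin m → Matrix ι ι ℂ}
    (h : Fin n → κ → ℝ) (a : Fin m → ℝ) (w : Fin m → Fin n → ℝ) (x : κ) (hV : ∀ i, (V i).IsHermitian) :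
    (condHamiltonianTilde V h a w x).IsHermitian := by
  unfold condHamiltonianTilde
  exact isSelfAdjoint_sum _ fun i _ => isHermitian_real_smul (hV i) _

lemma isHermitian_condHamiltonian (hV : ∀ i, (V i).IsHermitian) :
    (condHamiltonian V h a b w x).IsHermitian := by
  rw [condHamiltonian_eq_add]
  exact (isHermitian_real_smul Matrix.isHermitian_one _).add
    (isHermitian_condHamiltonianTilde h a w x hV)

variable [Fintype ι] (V)

lemma exp_smul_one_add (c : ℂ) (A : Matrix ι ι ℂ) :
    exp (c • (1 : Matrix ι ι ℂ) + A) = Complex.exp c • exp A := by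
  rw [Matrix.exp_add_of_commute _ _ ((Commute.one_left A).smul_left c)]
  have : exp (c • (1 : Matrix ι ι ℂ)) = Complex.exp c • 1 := by
    rw [Matrix.smul_one_eq_diagonal, Matrix.smul_one_eq_diagonal, Matrix.exp_diagonal]
    congr 1
    ext i
    rw [Pi.coe_exp, Complex.exp_eq_exp_ℂ]
  rw [this, Matrix.smul_mul, one_mul]

lemma thermal_smul_one_add (c : ℂ) (A : Matrix ι ι ℂ) :
    thermal (c • (1 : Matrix ι ι ℂ) + A) = thermal A := by
  rw [thermal, thermal, neg_add, ← neg_smul, exp_smul_one_add, Matrix.trace_smul, smul_smul,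
    smul_eq_mul, mul_inv, mul_right_comm, inv_mul_cancel₀ (Complex.exp_ne_zero _), one_mul]

/-- The scalar factors from the identity term on the two sides of `Y` are inverse to each other. -/
lemma Phi_smul_one_add (c : ℂ) (A Y : Matrix ι ι ℂ) :
    Phi (c • (1 : Matrix ι ι ℂ) + A) Y = Phi A Y := by
  unfold Phi
  simp only [smul_add, smul_smul, exp_smul_one_add, Matrix.smul_mul, Matrix.mul_smul]
  simp only [← Complex.exp_add]
  simp

end Machine

section Visible

variable {ι κ : Type*} [Fintype ι] [DecidableEq ι] [Fintype κ] [DecidableEq κ]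
  {m n : ℕ} {V : Fin m → Matrix ι ι ℂ} {H : Fin n → Matrix κ κ ℂ}
  {e : OrthonormalBasis κ ℂ (EuclideanSpace ℂ κ)} {h : Fin n → κ → ℝ}

lemma exp_neg_hamiltonian (hH : ∀ j, H j = ∑ x, (h j x : ℂ) • ketbra (e x))
    (a : Fin m → ℝ) (b : Fin n → ℝ) (w : Fin m → Fin n → ℝ) : exp (-hamiltonian V H a b w) =
      ∑ x, exp (-condHamiltonian V h a b w x) ⊗ₖ ketbra (e x) := by
  rw [← exp_sum_kronecker_ketbra, hamiltonian_eq_sum hH, ← Finset.sum_neg_distrib]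
  congr 1
  refine Finset.sum_congr rfl fun x _ => ?_
  rw [← neg_one_smul ℂ, ← Matrix.smul_kronecker, neg_one_smul]

lemma trace_exp_neg_hamiltonian (hH : ∀ j, H j = ∑ x, (h j x : ℂ) • ketbra (e x))
    (a : Fin m → ℝ) (b : Fin n → ℝ) (w : Fin m → Fin n → ℝ) :
    (exp (-hamiltonian V H a b w)).trace = partitionFunction (condHamiltonian V h a b w) := by
  rw [exp_neg_hamiltonian hH, trace_sum_kronecker_ketbra, partitionFunction]

/-- The eigenbasis depends only on `H`, so one choice serves all parameters and the identity can be
differentiated in them. -/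
lemma visibleState_eq (hH : ∀ j, H j = ∑ x, (h j x : ℂ) • ketbra (e x))
    (a : Fin m → ℝ) (b : Fin n → ℝ) (w : Fin m → Fin n → ℝ) :
    visibleState V H a b w = thermalMixture (condHamiltonian V h a b w) := by
  have hlin : ∀ (c : ℂ) (M : Matrix (ι × κ) (ι × κ) ℂ), partialTrace (c • M) = c • partialTrace M :=
    fun c M => by
      ext i j
      simp [partialTrace, Finset.mul_sum]
  rw [visibleState, thermal, hlin, trace_exp_neg_hamiltonian hH, exp_neg_hamiltonian hH,
    partialTrace_sum_kronecker_ketbra, thermalMixture]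

/-- Both traces are positive, so the real parts in the definition of `p` lose nothing. -/
lemma p_eq [Nonempty ι] [Nonempty κ] (hV : ∀ i, (V i).IsHermitian)
    (hH : ∀ j, H j = ∑ x, (h j x : ℂ) • ketbra (e x))
    (a : Fin m → ℝ) (b : Fin n → ℝ) (w : Fin m → Fin n → ℝ) (x : κ) :
    (p V H h a b w x : ℂ) = thermalWeight (condHamiltonian V h a b w) x := by
  have hG := fun x => isHermitian_condHamiltonian h a b w x hV
  rw [p, trace_exp_neg_hamiltonian hH, Complex.ofReal_div, thermalWeight,
    ← Complex.eq_re_of_ofReal_le (r := 0) (by simpa using (trace_exp_neg_pos hG x).le),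
    ← Complex.eq_re_of_ofReal_le (r := 0) (by simpa using (partitionFunction_pos hG).le)]

lemma Lambda_eq [Nonempty ι] [Nonempty κ] (hV : ∀ i, (V i).IsHermitian)
    (hH : ∀ j, H j = ∑ x, (h j x : ℂ) • ketbra (e x))
    (a : Fin m → ℝ) (b : Fin n → ℝ) (w : Fin m → Fin n → ℝ) (x : κ) :
    Lambda V H h a b w x = Upsilon (visibleState V H a b w) (matPow (visibleState V H a b w) (-1 / 2) *
      (thermalWeight (condHamiltonian V h a b w) x • thermal (condHamiltonian V h a b w x)) *
        matPow (visibleState V H a b w) (-1 / 2)) := by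
  rw [Lambda, p_eq hV hH, condState]

lemma isPOVM_Lambda [Nonempty ι] [Nonempty κ] (hV : ∀ i, (V i).IsHermitian)
    (hH : ∀ j, H j = ∑ x, (h j x : ℂ) • ketbra (e x))
    (a : Fin m → ℝ) (b : Fin n → ℝ) (w : Fin m → Fin n → ℝ) : IsPOVM (Lambda V H h a b w) := by
  have hG := fun x => isHermitian_condHamiltonian h a b w x hV
  set σ := visibleState V H a b w with hσdef
  have hσ : σ = thermalMixture (condHamiltonian V h a b w) := visibleState_eq hH a b w
  refine ⟨fun x => ?_, ?_⟩
  · rw [Lambda_eq hV hH]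
    refine posSemidef_Upsilon _ ?_
    have hpos : (thermalWeight (condHamiltonian V h a b w) x •
        thermal (condHamiltonian V h a b w x)).PosSemidef := by
      rw [thermalWeight_smul_thermal hG]
      exact (posDef_exp (hG x).neg).posSemidef.smul (inv_nonneg.2 (partitionFunction_pos hG).le)
    have h1 := hpos.mul_mul_conjTranspose_same (matPow σ (-1 / 2))
    rwa [(isHermitian_matPow_neg_half σ).eq] at h1
  · have hlin := (isChannel_Upsilon σ).1
    have h1 : ∑ x, Lambda V H h a b w x = Upsilon σ (∑ x, matPow σ (-1 / 2) *
      (thermalWeight (condHamiltonian V h a b w) x • thermal (condHamiltonian V h a b w x)) *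
        matPow σ (-1 / 2)) := by
      rw [Finset.sum_congr rfl fun x _ => Lambda_eq hV hH a b w x]
      exact (map_sum hlin.mk' _ _).symm
    rw [h1, ← Finset.sum_mul, ← Finset.mul_sum, sum_thermalWeight_smul_thermal hG, ← hσ,
      matPow_mul_self_mul_matPow (hσ ▸ posDef_thermalMixture hG), Upsilon_one]

/-- Writing `A = Cᴴ C` gives `Tr[A B] = Tr[C B Cᴴ]`. -/
lemma trace_mul_nonneg_of_posSemidef {A B : Matrix ι ι ℂ} (hA : A.PosSemidef) (hB : B.PosSemidef) :
    0 ≤ (A * B).trace := by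
  open scoped MatrixOrder in
  obtain ⟨C, rfl⟩ := CStarAlgebra.nonneg_iff_eq_star_mul_self.1 hA.nonneg
  rw [mul_assoc, Matrix.trace_mul_comm]
  exact (hB.mul_mul_conjTranspose_same C).trace_nonneg

lemma trace_Lambda_mul_nonneg [Nonempty ι] [Nonempty κ] (hV : ∀ i, (V i).IsHermitian)
    (hH : ∀ j, H j = ∑ x, (h j x : ℂ) • ketbra (e x)) {ρ : Matrix ι ι ℂ} (hρ : IsState ρ)
    (a : Fin m → ℝ) (b : Fin n → ℝ) (w : Fin m → Fin n → ℝ) (x : κ) :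
    0 ≤ (Lambda V H h a b w x * ρ).trace :=
  trace_mul_nonneg_of_posSemidef ((isPOVM_Lambda hV hH a b w).1 x) hρ.1

lemma q_eq [Nonempty ι] [Nonempty κ] (hV : ∀ i, (V i).IsHermitian)
    (hH : ∀ j, H j = ∑ x, (h j x : ℂ) • ketbra (e x)) {ρ : Matrix ι ι ℂ} (hρ : IsState ρ)
    (a : Fin m → ℝ) (b : Fin n → ℝ) (w : Fin m → Fin n → ℝ) (x : κ) :
    (q V H h a b w ρ x : ℂ) = (Lambda V H h a b w x * ρ).trace :=
  (Complex.eq_re_of_ofReal_le (r := 0)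
    (by simpa using trace_Lambda_mul_nonneg hV hH hρ a b w x)).symm

lemma isProbDist_q [Nonempty ι] [Nonempty κ] (hV : ∀ i, (V i).IsHermitian)
    (hH : ∀ j, H j = ∑ x, (h j x : ℂ) • ketbra (e x)) {ρ : Matrix ι ι ℂ} (hρ : IsState ρ)
    (a : Fin m → ℝ) (b : Fin n → ℝ) (w : Fin m → Fin n → ℝ) :
    IsProbDist (q V H h a b w ρ) := by
  refine ⟨fun x => (Complex.nonneg_iff.1 (trace_Lambda_mul_nonneg hV hH hρ a b w x)).1, ?_⟩
  apply Complex.ofReal_injective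
  rw [Complex.ofReal_sum, Finset.sum_congr rfl fun x _ => q_eq hV hH hρ a b w x,
    ← Matrix.trace_sum, ← Finset.sum_mul, (isPOVM_Lambda hV hH a b w).2, one_mul, hρ.2,
    Complex.ofReal_one]

/-- `Φ` preserves the trace, `trace_Xi` removes the anticommutator, and self-adjointness moves `Υ`
from `ρ` onto the measurement operator. This is what makes `q` appear in the `b`-derivative. -/
lemma p_mul_trace_SigmaMap [Nonempty ι] [Nonempty κ] (hV : ∀ i, (V i).IsHermitian)
    (hH : ∀ j, H j = ∑ x, (h j x : ℂ) • ketbra (e x)) {ρ : Matrix ι ι ℂ} (hρ : IsState ρ)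
    (a : Fin m → ℝ) (b : Fin n → ℝ) (w : Fin m → Fin n → ℝ) (x : κ) :
    (p V H h a b w x : ℂ) * (SigmaMap V H h a b w x ρ).trace = q V H h a b w ρ x := by
  rw [q_eq hV hH hρ, SigmaMap, (isChannel_Phi (isHermitian_condHamiltonian h a b w x hV)).2.2,
    trace_Xi, Lambda, ← trace_mul_Upsilon, Matrix.mul_smul, Matrix.smul_mul, Matrix.smul_mul,
    Matrix.trace_smul, smul_eq_mul]

/-- The derivative of the relative entropy along a straight line of conditional Hamiltonians. -/
lemma hasDerivAt_relEntropy_visibleState [Nonempty ι] [Nonempty κ] (hV : ∀ i, (V i).IsHermitian)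
    (hH : ∀ j, H j = ∑ x, (h j x : ℂ) • ketbra (e x)) {ρ : Matrix ι ι ℂ} (hρ : IsState ρ)
    {a : ℝ → Fin m → ℝ} {b : ℝ → Fin n → ℝ} {w : ℝ → Fin m → Fin n → ℝ} {s₀ : ℝ}
    {a₀ : Fin m → ℝ} {b₀ : Fin n → ℝ} {w₀ : Fin m → Fin n → ℝ} {K : κ → Matrix ι ι ℂ}
    (hK : ∀ s x, condHamiltonian V h (a s) (b s) (w s) x =
      condHamiltonian V h a₀ b₀ w₀ x + ((s - s₀ : ℝ) : ℂ) • K x) :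
    HasDerivAt (fun s => ((relEntropy ρ (visibleState V H (a s) (b s) (w s)) : ℝ) : ℂ))
      (∑ x, (p V H h a₀ b₀ w₀ x : ℂ) * expval (K x) (SigmaMap V H h a₀ b₀ w₀ x ρ) -
        ∑ x, (p V H h a₀ b₀ w₀ x : ℂ) * expval (K x) (condState V h a₀ b₀ w₀ x)) s₀ := by
  have hG : ∀ s x, (condHamiltonian V h (a s) (b s) (w s) x).IsHermitian := fun s x =>
    isHermitian_condHamiltonian h (a s) (b s) (w s) x hV
  have hline : ∀ x, open scoped Matrix.Norms.L2Operator in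
      HasDerivAt (fun s => condHamiltonian V h (a s) (b s) (w s) x) (K x) s₀ := fun x => by
    open scoped Matrix.Norms.L2Operator in
    have h1 := ((((hasDerivAt_id s₀).sub_const s₀).ofReal_comp).smul_const (K x)).const_add
      (condHamiltonian V h a₀ b₀ w₀ x)
    rw [Complex.ofReal_one, one_smul] at h1
    exact h1.congr_of_eventuallyEq (.of_forall fun s => hK s x)
  have h2 := hasDerivAt_relEntropy_thermalMixture hρ hG hline
  have h3 : condHamiltonian V h (a s₀) (b s₀) (w s₀) = condHamiltonian V h a₀ b₀ w₀ := by
    ext1 x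
    rw [hK, sub_self, Complex.ofReal_zero, zero_smul, add_zero]
  simp only [h3] at h2
  simp only [visibleState_eq hH, SigmaMap, condState, p_eq hV hH]
  exact h2

end Visible
end QCBM

/-! ### The gradient theorem -/

theorem mainTheorem11 {ι κ : Type*} [Fintype ι] [DecidableEq ι] [Fintype κ] [DecidableEq κ]
    [Nonempty κ] {m n : ℕ}
    (V : Fin m → Matrix ι ι ℂ) (hV : ∀ i, (V i).IsHermitian)
    (H : Fin n → Matrix κ κ ℂ) (hH : ∀ j, (H j).IsHermitian)
    (hcomm : ∀ j k, Commute (H j) (H k))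
    (ρ : Matrix ι ι ℂ) (hρ : QCBM.IsState ρ)
    (a : Fin m → ℝ) (b : Fin n → ℝ) (w : Fin m → Fin n → ℝ) :
    -- the commuting hidden terms have a joint eigenbasis
    (∃ (e : OrthonormalBasis κ ℂ (EuclideanSpace ℂ κ)) (h : Fin n → κ → ℝ),
      ∀ j, H j = ∑ x, (h j x : ℂ) • QCBM.ketbra (e x)) ∧
    -- and the gradient formulas hold with respect to every one
    ∀ (e : OrthonormalBasis κ ℂ (EuclideanSpace ℂ κ)) (h : Fin n → κ → ℝ),
      (∀ j, H j = ∑ x, (h j x : ℂ) • QCBM.ketbra (e x)) →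
        -- `Λ` is a measurement, with outcome distribution `q`
        QCBM.IsPOVM (QCBM.Lambda V H h a b w) ∧
        QCBM.IsProbDist (QCBM.q V H h a b w ρ) ∧
        (∀ x, (QCBM.q V H h a b w ρ x : ℂ) = (QCBM.Lambda V H h a b w x * ρ).trace) ∧
        -- the partial derivatives
        (∀ i, HasDerivAt
          (fun s : ℝ => ((QCBM.relEntropy ρ
            (QCBM.visibleState V H (Function.update a i s) b w) : ℝ) : ℂ))
          (∑ x, (QCBM.p V H h a b w x : ℂ) *
              QCBM.expval (V i) (QCBM.SigmaMap V H h a b w x ρ) -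
            ∑ x, (QCBM.p V H h a b w x : ℂ) *
              QCBM.expval (V i) (QCBM.condState V h a b w x))
          (a i)) ∧
        (∀ j, HasDerivAt
          (fun s : ℝ => QCBM.relEntropy ρ
            (QCBM.visibleState V H a (Function.update b j s) w))
          (∑ x, QCBM.q V H h a b w ρ x * h j x - ∑ x, QCBM.p V H h a b w x * h j x)
          (b j)) ∧
        (∀ i j, HasDerivAt
          (fun s : ℝ => ((QCBM.relEntropy ρ
            (QCBM.visibleState V H a b
              (Function.update w i (Function.update (w i) j s))) : ℝ) : ℂ))
          (∑ x, (QCBM.p V H h a b w x : ℂ) * (h j x : ℂ) *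
              QCBM.expval (V i) (QCBM.SigmaMap V H h a b w x ρ) -
            ∑ x, (QCBM.p V H h a b w x : ℂ) * (h j x : ℂ) *
              QCBM.expval (V i) (QCBM.condState V h a b w x))
          (w i j)) ∧
        -- neither `σ_v^x` nor the quantum channel `Φ_v^{θ,x}` depends on `b`
        (∀ x, QCBM.condState V h a b w x =
          QCBM.thermal (QCBM.condHamiltonianTilde V h a w x)) ∧
        (∀ x, QCBM.IsChannel (QCBM.Phi (QCBM.condHamiltonian V h a b w x))) ∧
        (∀ x Y, QCBM.Phi (QCBM.condHamiltonian V h a b w x) Y =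
          QCBM.Phi (QCBM.condHamiltonianTilde V h a w x) Y) := by
  
  refine ⟨QCBM.exists_orthonormalBasis_joint_eigenvectors H hH hcomm, fun e h he => ?_⟩
  -- The visible space is nonzero because `ρ` has unit trace.
  have hι : Nonempty ι := by
    by_contra hne
    rw [not_nonempty_iff] at hne
    simpa [Matrix.trace] using hρ.2
  have hG := fun x => QCBM.isHermitian_condHamiltonian h a b w x hV
  refine ⟨QCBM.isPOVM_Lambda hV he a b w, QCBM.isProbDist_q hV he hρ a b w,
    QCBM.q_eq hV he hρ a b w, fun i => ?_, fun j => ?_, fun i j => ?_, fun x => ?_,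
    fun x => QCBM.isChannel_Phi (hG x), fun x Y => ?_⟩
  · exact QCBM.hasDerivAt_relEntropy_visibleState hV he hρ
      fun s x => QCBM.condHamiltonian_update_left V h a b w x i s
  · have hd := QCBM.hasDerivAt_relEntropy_visibleState hV he hρ
      fun s x => QCBM.condHamiltonian_update_mid V h a b w x j s
    -- The direction is the scalar `h_{j,x}`, so expectations reduce to traces: `qₓ` for the data
    -- term and `pₓ` for the model term.
    have hq : ∀ x, (QCBM.p V H h a b w x : ℂ) * QCBM.expval ((h j x : ℂ) • 1)
        (QCBM.SigmaMap V H h a b w x ρ) = ((QCBM.q V H h a b w ρ x * h j x : ℝ) : ℂ) := fun x => by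
      rw [QCBM.expval, Matrix.smul_mul, one_mul, Matrix.trace_smul, smul_eq_mul, mul_left_comm,
        QCBM.p_mul_trace_SigmaMap hV he hρ, mul_comm, Complex.ofReal_mul]
    have hp : ∀ x, (QCBM.p V H h a b w x : ℂ) * QCBM.expval ((h j x : ℂ) • 1)
        (QCBM.condState V h a b w x) = ((QCBM.p V H h a b w x * h j x : ℝ) : ℂ) := fun x => by
      rw [QCBM.expval, Matrix.smul_mul, one_mul, Matrix.trace_smul, smul_eq_mul, QCBM.condState,
        QCBM.trace_thermal (hG x), mul_one, Complex.ofReal_mul]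
    simp only [hq, hp, ← Complex.ofReal_sum, ← Complex.ofReal_sub] at hd
    -- The derivative is now visibly real, and composing with the real part gives the real-valued
    -- statement.
    exact Complex.reCLM.hasFDerivAt.comp_hasDerivAt (b j) hd
  · have hd := QCBM.hasDerivAt_relEntropy_visibleState hV he hρ
      fun s x => QCBM.condHamiltonian_update_right V h a b w x i j s
    refine hd.congr_deriv ?_
    simp only [QCBM.expval, Matrix.smul_mul, Matrix.trace_smul, smul_eq_mul, mul_assoc]
  · rw [QCBM.condState, QCBM.condHamiltonian_eq_add, QCBM.thermal_smul_one_add]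
  · rw [QCBM.condHamiltonian_eq_add, QCBM.Phi_smul_one_add]
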